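/- **Model.** A network consists of a finite set $V$ of peers, one of which is the source, and two *layers*, each a 1-regular digraph on $V$ (every peer $v$ has exactly one outgoing edge $(v,c_m(v))$ and exactly one incoming edge in layer $m\in\{1,2\}$; loops are allowed). It is produced by the following random peer-pairing algorithm. Initially $V$ contains only the source, with a loop in each layer. When a new peer $v$ joins, $V$ is replaced by $V\cup\{v\}$ and $w_1,w_2$ are drawn independently and uniformly from the new set $V$ (independently of the past); for each $m$, if $w_m=v$ then $v$ gets a loop in layer $m$, and otherwise the edge $(w_m,c_m(w_m))$ of layer $m$ is replaced by $(w_m,v)$ and $(v,c_m(w_m))$. When a peer $v$ other than the source leaves, in each layer its incoming edge $(u,v)$ and outgoing edge $(v,c_m(v))$ are replaced by $(u,c_m(v))$ (a loop at $v$ is just removed). The sequence of arrivals and departures is arbitrary but deterministic. (At any time the union of the two layers is thus a superposition of two random 1-regular digraphs on $V$.) Consider the network at a time when $|V|=N$. The depth of a peer is its directed distance from the source in the union of the two layers. Let $N_d$ be the number of peers of depth $d$, and let $N_{>d}$ be the number of peers whose depth is not in $\{0,\dots,d\}$, unreachable peers included (so $N_{>-1}=N$). Fix $0<c<1$ and,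 with $\log$ the natural logarithm, put $$d_1=\left\lceil\tfrac{\log_2 N}{3}\right\rceil,\qquad d_2=\left\lceil\tfrac{5\log_2 N}{6}\right\rceil,\qquad d^*=\left\lceil\log_2\frac{N}{\log^c N}\right\rceil,$$ $$\phi_d=\begin{cases}1,&0\le d<d_1,\\ 1-N^{-1/9},&d_1\le d<d_2,\\ \left(1-\dfrac{N_d}{N_{>d-1}}\right)^3,&d_2\le d<d^*.\end{cases}$$ **Claim.** For every $c\in(0,1)$ and every $\epsilon>0$ there is $N_0$, depending only on $c$ and $\epsilon$, such that for all $N>N_0$ and every sequence of arrivals and departures leading to $N$ peers, $$\Pr\left[N_{d^*}\ge\frac{(1-\epsilon)N}{\log^c N}\ \text{ and }\ N_d\ge 2\phi_{d-1}N_{d-1}\ \text{ for all } 1\le d\le d^*\right]\ \ge\ 1-\frac{2(1+\epsilon)\log_2 N}{N^{1/3}}.$$ -/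

import Mathlib

/-- The topology of the network: for each of the two layers, the map sending a peer to its child
in that layer. Peers are labelled by natural numbers. A 1-regular digraph on the current finite
peer set `V` is a permutation of `V`, extended by the identity outside `V`; the parent map of
layer `m` is the inverse permutation. -/
abbrev Layers : Type := Fin 2 → Equiv.Perm ℕ

/-- The source peer. -/
def source : ℕ := 1

/-- Peer `v` (not yet present, hence a fixed point of `c`) enters a layer with child map `c`.
If `w = v` it creates a loop; otherwise the edge `(w, c w)` is replaced by `(w, v)` and
`(v, c w)`. -/
def joinLayer (v w : ℕ) (c : Equiv.Perm ℕ) : Equiv.Perm ℕ := c * Equiv.swap w v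

/-- Peer `v` leaves a layer with child map `c`: the edges `(u, v)` and `(v, c v)` are replaced by
the edge `(u, c v)`, and `v` becomes a fixed point. -/
def leaveLayer (v : ℕ) (c : Equiv.Perm ℕ) : Equiv.Perm ℕ := Equiv.swap v (c v) * c

/-- Two peers drawn independently and uniformly from `V`, repetition allowed, one per layer. -/
noncomputable def drawTwo (V : Finset ℕ) (hV : V.Nonempty) : PMF (Fin 2 → ℕ) :=
  PMF.uniformOfFinset (Fintype.piFinset fun _ : Fin 2 => V)
    (Fintype.piFinset_nonempty.2 fun _ => hV)

/-- `PeerPairingLaw V μ`: after some sequence of arrivals and departures (fixed in advance, the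
source never departs) the set of present peers is `V`, and `μ` is the distribution of the two
layers produced by the peer-pairing algorithm. -/
inductive PeerPairingLaw : Finset ℕ → PMF Layers → Prop
  | start : PeerPairingLaw {source} (PMF.pure fun _ => 1)
  | join {V : Finset ℕ} {μ : PMF Layers} (v : ℕ) (hv : v ∉ V) (h : PeerPairingLaw V μ) :
      PeerPairingLaw (insert v V)
        (μ.bind fun c =>
          (drawTwo (insert v V) (Finset.insert_nonempty v V)).map fun w m =>
            joinLayer v (w m) (c m))
  | leave {V : Finset ℕ} {μ : PMF Layers} (v : ℕ) (hv : v ∈ V) (hs : v ≠ source)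
      (h : PeerPairingLaw V μ) :
      PeerPairingLaw (V.erase v) (μ.map fun c m => leaveLayer v (c m))

/-- There is a directed walk with exactly `n` edges, each from either layer, from the source
to `v`. -/
def ReachIn (c : Layers) : ℕ → ℕ → Prop
  | 0, v => v = source
  | n + 1, v => ∃ u, ReachIn c n u ∧ ∃ m, c m u = v

/-- The peer `v` is at depth `d`: a shortest directed walk from the source to `v` in the union
of the two layers has `d` edges. -/
def IsDepth (c : Layers) (d v : ℕ) : Prop := ReachIn c d v ∧ ∀ k < d, ¬ ReachIn c k v

open scoped Classical in
/-- `N_d`, the number of peers at depth `d`. -/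
noncomputable def numDepth (V : Finset ℕ) (c : Layers) (d : ℕ) : ℕ :=
  (V.filter fun v => IsDepth c d v).card

open scoped Classical in
/-- `N_{> d-1}`, the number of peers that are not at any of the depths `0, …, d-1`
(unreachable peers are counted). -/
noncomputable def numFrom (V : Finset ℕ) (c : Layers) (d : ℕ) : ℕ :=
  (V.filter fun v => ∀ k < d, ¬ IsDepth c k v).card

/-- `d₁ = ⌈(log₂ N) / 3⌉`. -/
noncomputable def depthOne (N : ℕ) : ℕ := ⌈Real.logb 2 N / 3⌉₊

/-- `d₂ = ⌈(5 log₂ N) / 6⌉`. -/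
noncomputable def depthTwo (N : ℕ) : ℕ := ⌈5 * Real.logb 2 N / 6⌉₊

/-- `d* = ⌈log₂ (N / log^c N)⌉`. -/
noncomputable def depthStar (c : ℝ) (N : ℕ) : ℕ := ⌈Real.logb 2 (N / Real.log N ^ c)⌉₊

/-- The growth factor `φ_d`, used for `d < d*`. -/
noncomputable def growth (V : Finset ℕ) (L : Layers) (d : ℕ) : ℝ :=
  if d < depthOne V.card then 1
  else if d < depthTwo V.card then 1 - (V.card : ℝ) ^ (-(1 / 9) : ℝ)
  else (1 - (numDepth V L d : ℝ) / (numFrom V L d : ℝ)) ^ 3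

/-!
At any time the two layers are independent uniform permutations of the peer set `V`
(`PeerPairingLaw.eq_uniform`): an arrival is a bijection between pairs (permutation of `V`, parent of
the new peer) and permutations of the enlarged set, and a departure forgets the child of the departed
peer. Everything else is a statement about two uniform permutations, proved by counting.

Reveal the edges in order of the depth of their tails. Given the edges leaving the peers of depth
less than `d`, the other edges of each layer form a uniform bijection from the `M = N_{> d-1}`
remaining peers to `M` remaining targets (`card_filter_history`), and the next sphere consists of
the `M - n` unexplored peers that are hit by the `n = N_d` edges leaving the current sphere
in at least one layer (`numDepth_succ_add_missed`). Second moments of the number of missed peers show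
that `N_{d+1}` has conditional mean at least `2 n - 3 n ^ 2 / M` and conditional variance at most
`3 n ^ 2 / (M - 1)` (`sum_missed`, `sum_missed_sq`, `missed_variance_le`).

The growth bound at depth `d` then fails with conditional probability at most `3 n ^ 2 / M`
for `d < d₁`, by Markov's inequality for the number of collisions `2 n - N_{d+1}`, which is
`O(N ^ (-1/3))` because `n ≤ 2 ^ d`. For `d ≥ d₁`, Chebyshev's inequality gives the failure
probability `O(N ^ (-2/3))`; for `d ≥ d₂` this uses that `n` is close to `2 ^ d` as long as
the growth bound has not failed (`two_pow_mul_le_numDepth`). The same lower bound at `d = d*` gives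
the size of the last sphere, and a union bound over the depth of the first failure
(`card_filter_not_growsUpTo_le`) gives the probability: the `(log₂ N) / 3 + O(1)` depths below `d₁`
contribute `6 N ^ (-1/3)` each, and the remaining ones are negligible.
-/

/-! ### The law of the layers is uniform -/

/-- Pairs of permutations of `V` (extended by the identity): all possible pairs of layers on the
peer set `V`. -/
def layerSet (V : Finset ℕ) : Finset Layers := Fintype.piFinset fun _ => permsOfFinset V

theorem mem_permsOfFinset {V : Finset ℕ} {σ : Equiv.Perm ℕ} :
    σ ∈ permsOfFinset V ↔ ∀ x, x ∉ V → σ x = x := by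
  rw [mem_perms_of_finset_iff]
  exact ⟨fun h x hx => by_contra fun h' => hx (h h'), fun h x hx => by_contra fun h' => hx (h x h')⟩

theorem mem_layerSet {V : Finset ℕ} {c : Layers} :
    c ∈ layerSet V ↔ ∀ m x, x ∉ V → c m x = x := by
  simp [layerSet, mem_permsOfFinset]

theorem one_mem_permsOfFinset (V : Finset ℕ) : 1 ∈ permsOfFinset V := by
  simp [mem_permsOfFinset]

theorem layerSet_nonempty (V : Finset ℕ) : (layerSet V).Nonempty :=
  Fintype.piFinset_nonempty.2 fun _ => ⟨1, one_mem_permsOfFinset V⟩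

theorem apply_mem_of_mem_permsOfFinset {V : Finset ℕ} {σ : Equiv.Perm ℕ}
    (hσ : σ ∈ permsOfFinset V) {x : ℕ} (hx : x ∈ V) : σ x ∈ V := by
  by_contra h
  have h1 := mem_permsOfFinset.1 hσ _ h
  rw [σ.injective h1] at h
  exact h hx

theorem inv_mem_permsOfFinset {V : Finset ℕ} {σ : Equiv.Perm ℕ}
    (hσ : σ ∈ permsOfFinset V) : σ⁻¹ ∈ permsOfFinset V := by
  rw [mem_permsOfFinset] at hσ ⊢
  intro x hx
  rw [Equiv.Perm.inv_eq_iff_eq]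
  exact (hσ x hx).symm

theorem mul_mem_permsOfFinset {V : Finset ℕ} {σ τ : Equiv.Perm ℕ}
    (hσ : σ ∈ permsOfFinset V) (hτ : τ ∈ permsOfFinset V) : σ * τ ∈ permsOfFinset V := by
  rw [mem_permsOfFinset] at hσ hτ ⊢
  intro x hx
  rw [Equiv.Perm.mul_apply, hτ x hx, hσ x hx]

theorem swap_mem_permsOfFinset {V : Finset ℕ} {x y : ℕ} (hx : x ∈ V) (hy : y ∈ V) :
    Equiv.swap x y ∈ permsOfFinset V := by
  rw [mem_permsOfFinset]
  intro z hz
  exact Equiv.swap_apply_of_ne_of_ne (by rintro rfl; exact hz hx) (by rintro rfl; exact hz hy)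

theorem permsOfFinset_mono {V W : Finset ℕ} (h : V ⊆ W) : permsOfFinset V ⊆ permsOfFinset W := by
  intro σ hσ
  rw [mem_permsOfFinset] at hσ ⊢
  exact fun x hx => hσ x fun h' => hx (h h')

open scoped Classical in
/-- A map all of whose fibres over `t` have the same size pushes the uniform distribution forward
to the uniform distribution. -/
theorem map_uniformOfFinset {α β : Type*} {s : Finset α} {t : Finset β}
    (hs : s.Nonempty) (ht : t.Nonempty) (f : α → β) (k : ℕ) (hf : ∀ a ∈ s, f a ∈ t)
    (hk : ∀ b ∈ t, (s.filter fun a => f a = b).card = k) :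
    (PMF.uniformOfFinset s hs).map f = PMF.uniformOfFinset t ht := by
  have hcard : s.card = t.card * k := by
    rw [Finset.card_eq_sum_card_fiberwise hf, Finset.sum_congr rfl hk]
    simp
  have hk0 : k ≠ 0 := by
    rintro rfl
    simp at hcard
    exact hs.ne_empty hcard
  ext b
  rw [PMF.map_apply, tsum_eq_sum (s := s) (by
    intro a ha
    simp [ha])]
  refine (Finset.sum_congr rfl
    (g := fun a => if f a = b then (s.card : ENNReal)⁻¹ else 0) fun a ha => ?_).trans ?_
  · rw [PMF.uniformOfFinset_apply_of_mem hs ha]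
    by_cases h : f a = b
    · simp [h]
    · simp [h, Ne.symm h]
  rw [← Finset.sum_filter, Finset.sum_const, nsmul_eq_mul]
  by_cases hb : b ∈ t
  · rw [hk b hb, PMF.uniformOfFinset_apply_of_mem ht hb, hcard, Nat.cast_mul,
      ENNReal.mul_inv (by simp) (by simp), mul_comm, mul_assoc,
      ENNReal.inv_mul_cancel (by exact_mod_cast hk0) (by simp), mul_one]
  · rw [PMF.uniformOfFinset_apply_of_notMem ht hb, Finset.filter_eq_empty_iff.2]
    · simp
    · rintro a ha rfl
      exact hb (hf a ha)

theorem bind_map_uniformOfFinset {α β γ : Type*} {s : Finset α} {t : Finset β}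
    (hs : s.Nonempty) (ht : t.Nonempty) (f : α → β → γ) :
    ((PMF.uniformOfFinset s hs).bind fun a => (PMF.uniformOfFinset t ht).map (f a)) =
      (PMF.uniformOfFinset (s ×ˢ t) (hs.product ht)).map fun p => f p.1 p.2 := by
  have key : PMF.uniformOfFinset (s ×ˢ t) (hs.product ht) =
      (PMF.uniformOfFinset s hs).bind fun a => (PMF.uniformOfFinset t ht).map (Prod.mk a) := by
    classical
    ext ⟨x, y⟩
    rw [PMF.bind_apply, tsum_eq_single x]
    · rw [PMF.map_apply, tsum_eq_single y]
      · by_cases hx : x ∈ s <;> by_cases hy : y ∈ t <;>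
          simp [PMF.uniformOfFinset_apply, hx, hy, ENNReal.mul_inv]
      · intro y' hy'
        simp [hy'.symm]
    · intro x' hx'
      simp [PMF.map_apply, hx'.symm]
  rw [key, PMF.map_bind]
  congr 1
  funext a
  rw [PMF.map_comp]
  rfl

open scoped Classical in
/-- Drawing a permutation of `V` and a point `w` of `insert v V` and letting `v` enter below `w`
produces every permutation of `insert v V` exactly once: `w` is recovered as the parent of `v`. -/
theorem card_filter_joinLayer {V : Finset ℕ} {v : ℕ} (hv : v ∉ V) {b : Layers}
    (hb : b ∈ layerSet (insert v V)) :
    ((layerSet V ×ˢ (Fintype.piFinset fun _ : Fin 2 => insert v V)).filter fun p : Layers × (Fin 2 → ℕ) =>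
      (fun m => joinLayer v (p.2 m) (p.1 m)) = b).card = 1 := by
  have hb' : ∀ m, b m ∈ permsOfFinset (insert v V) := fun m => by
    simpa [layerSet] using Fintype.mem_piFinset.1 hb m
  rw [Finset.card_eq_one]
  refine ⟨(fun m => b m * Equiv.swap ((b m)⁻¹ v) v, fun m => (b m)⁻¹ v), ?_⟩
  ext ⟨c, w⟩
  rw [Finset.mem_filter]
  simp only [Finset.mem_product, Finset.mem_singleton, Prod.mk.injEq, mem_layerSet,
    Fintype.mem_piFinset, joinLayer]
  constructor
  · rintro ⟨⟨hc, -⟩, rfl⟩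
    have hw : ∀ m, (c m * Equiv.swap (w m) v)⁻¹ v = w m := by
      intro m
      rw [Equiv.Perm.inv_eq_iff_eq]
      simp [hc m v hv]
    constructor
    · funext m
      simp only [hw, mul_assoc, Equiv.swap_mul_self, mul_one]
    · funext m
      exact (hw m).symm
  · rintro ⟨rfl, rfl⟩
    refine ⟨⟨?_, fun m => ?_⟩, ?_⟩
    · intro m x hx
      have hinv := inv_mem_permsOfFinset (hb' m)
      rw [Equiv.Perm.mul_apply]
      by_cases hxv : x = v
      · subst hxv
        simp
      · have hx' : x ∉ insert v V := by simp [hxv, hx]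
        rw [Equiv.swap_apply_of_ne_of_ne _ hxv]
        · exact mem_permsOfFinset.1 (hb' m) x hx'
        · rintro rfl
          exact hx' (apply_mem_of_mem_permsOfFinset hinv (by simp))
    · exact apply_mem_of_mem_permsOfFinset (inv_mem_permsOfFinset (hb' m)) (by simp)
    · funext m
      simp [mul_assoc]

open scoped Classical in
/-- Each pair of layers on `V.erase v` arises from `|V| ^ 2` pairs of layers on `V` when `v`
leaves, one for every choice of the two children of `v`. -/
theorem card_filter_leaveLayer {V : Finset ℕ} {v : ℕ} (hv : v ∈ V) {b : Layers}
    (hb : b ∈ layerSet (V.erase v)) :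
    ((layerSet V).filter fun c : Layers => (fun m => leaveLayer v (c m)) = b).card =
      (Fintype.piFinset fun _ : Fin 2 => V).card := by
  have hbv : ∀ m, b m v = v := fun m => mem_layerSet.1 hb m v (by simp)
  refine Finset.card_nbij' (fun c m => c m v) (fun w m => Equiv.swap v (w m) * b m) ?_ ?_ ?_ ?_
  · intro c hc
    simp only [Finset.coe_filter, Set.mem_ofPred_eq, layerSet, Fintype.mem_piFinset] at hc
    simp only [Finset.mem_coe, Fintype.mem_piFinset]
    exact fun m => apply_mem_of_mem_permsOfFinset (hc.1 m) hv
  · intro w hw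
    simp only [Finset.mem_coe, Fintype.mem_piFinset] at hw
    simp only [Finset.coe_filter, Set.mem_ofPred_eq, layerSet, Fintype.mem_piFinset]
    refine ⟨fun m => mul_mem_permsOfFinset (swap_mem_permsOfFinset hv (hw m)) ?_, ?_⟩
    · exact permsOfFinset_mono (Finset.erase_subset v V) (Fintype.mem_piFinset.1 hb m)
    · funext m
      simp [leaveLayer, hbv m]
  · intro c hc
    simp only [Finset.coe_filter, Set.mem_ofPred_eq] at hc
    funext m
    rw [← hc.2]
    simp [leaveLayer]
  · intro w _
    funext m
    simp [hbv m]

/-- At any time the two layers are independent uniform permutations of the current peer set. -/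
theorem PeerPairingLaw.eq_uniform {V : Finset ℕ} {μ : PMF Layers} (h : PeerPairingLaw V μ) :
    source ∈ V ∧ μ = PMF.uniformOfFinset (layerSet V) (layerSet_nonempty V) := by
  induction h with
  | start =>
    refine ⟨by simp, ?_⟩
    have h1 : layerSet {source} = {fun _ => 1} := by
      ext c
      rw [mem_layerSet, Finset.mem_singleton]
      constructor
      · intro h
        funext m
        ext x
        by_cases hx : x = source
        · by_contra hne
          have h2 := h m (c m x) (by simpa [hx] using hne)
          exact hne ((c m).injective h2)
        · exact h m x (by simpa using hx)
      · rintro rfl m x _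
        rfl
    ext c
    by_cases hc : c = fun _ => 1 <;>
      simp [PMF.pure_apply, PMF.uniformOfFinset_apply, h1, hc]
  | @join V μ v hv h ih =>
    refine ⟨Finset.mem_insert_of_mem ih.1, ?_⟩
    rw [ih.2]
    unfold drawTwo
    rw [bind_map_uniformOfFinset (layerSet_nonempty V) _
      (fun (c : Layers) (w : Fin 2 → ℕ) (m : Fin 2) => joinLayer v (w m) (c m))]
    refine map_uniformOfFinset _ _ _ 1 ?_ fun b hb => by
      convert card_filter_joinLayer hv hb
    rintro ⟨c, w⟩ hp
    simp only [Finset.mem_product, layerSet, Fintype.mem_piFinset] at hp ⊢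
    intro m
    exact mul_mem_permsOfFinset (permsOfFinset_mono (Finset.subset_insert v V) (hp.1 m))
      (swap_mem_permsOfFinset (hp.2 m) (by simp))
  | @leave V μ v hv hs h ih =>
    refine ⟨Finset.mem_erase.2 ⟨hs.symm, ih.1⟩, ?_⟩
    rw [ih.2]
    refine map_uniformOfFinset _ _ _ (Fintype.piFinset fun _ : Fin 2 => V).card ?_ fun b hb => by
      convert card_filter_leaveLayer hv hb
    intro c hc
    simp only [layerSet, Fintype.mem_piFinset] at hc
    rw [mem_layerSet]
    intro m x hx
    simp only [leaveLayer, Equiv.Perm.mul_apply]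
    by_cases hxv : x = v
    · simp [hxv]
    · have hxV : x ∉ V := fun h' => hx (Finset.mem_erase.2 ⟨hxv, h'⟩)
      rw [mem_permsOfFinset.1 (hc m) x hxV]
      refine Equiv.swap_apply_of_ne_of_ne hxv ?_
      rintro rfl
      exact hxV (apply_mem_of_mem_permsOfFinset (hc m) hv)

/-! ### Moments of the number of points missed by two random permutations -/

/-- The distribution of `τ⁻¹` at a pair of points does not change when the points are moved by a
permutation of `W`. -/
theorem card_filter_inv_apply_perm {W : Finset ℕ} {π : Equiv.Perm ℕ} (hπ : π ∈ permsOfFinset W)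
    (A : Finset ℕ) (y z : ℕ) :
    ((permsOfFinset W).filter fun τ => τ⁻¹ (π y) ∈ A ∧ τ⁻¹ (π z) ∈ A).card =
      ((permsOfFinset W).filter fun τ => τ⁻¹ y ∈ A ∧ τ⁻¹ z ∈ A).card := by
  refine Finset.card_nbij' (fun τ => π⁻¹ * τ) (fun τ => π * τ) ?_ ?_ ?_ ?_
  · intro τ hτ
    simp only [Finset.coe_filter, Set.mem_ofPred_eq] at hτ ⊢
    refine ⟨mul_mem_permsOfFinset (inv_mem_permsOfFinset hπ) hτ.1, ?_⟩
    simpa [mul_inv_rev] using hτ.2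
  · intro τ hτ
    simp only [Finset.coe_filter, Set.mem_ofPred_eq] at hτ ⊢
    refine ⟨mul_mem_permsOfFinset hπ hτ.1, ?_⟩
    simpa [mul_inv_rev] using hτ.2
  · intro τ _
    simp
  · intro τ _
    simp

/-- Permutations of `W` act transitively on ordered pairs of distinct points. -/
theorem exists_perm_apply_pair {W : Finset ℕ} {y z y' z' : ℕ} (hy : y ∈ W) (hz : z ∈ W)
    (hyz : y ≠ z) (hy' : y' ∈ W) (hz' : z' ∈ W) (hyz' : y' ≠ z') :
    ∃ π ∈ permsOfFinset W, π y = y' ∧ π z = z' := by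
  have hs := swap_mem_permsOfFinset hy hy'
  refine ⟨Equiv.swap (Equiv.swap y y' z) z' * Equiv.swap y y', mul_mem_permsOfFinset
    (swap_mem_permsOfFinset (apply_mem_of_mem_permsOfFinset hs hz) hz') hs, ?_, ?_⟩
  · rw [Equiv.Perm.mul_apply, Equiv.swap_apply_left]
    refine Equiv.swap_apply_of_ne_of_ne (fun h => hyz ?_) hyz'
    rw [← Equiv.swap_apply_left y y'] at h
    exact (Equiv.swap y y').injective (by simpa using h)
  · simp

theorem card_filter_inv_apply {W A : Finset ℕ} (hA : A ⊆ W) {y : ℕ} (hy : y ∈ W) :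
    (((permsOfFinset W).filter fun τ => τ⁻¹ y ∈ A).card : ℝ) =
      (W.card).factorial * (A.card / W.card) := by
  have hW : (W.card : ℝ) ≠ 0 := by
    exact_mod_cast (Finset.card_pos.2 ⟨y, hy⟩).ne'
  have h1 : ∑ z ∈ W, ((permsOfFinset W).filter fun τ => τ⁻¹ z ∈ A).card =
      ∑ τ ∈ permsOfFinset W, A.card := by
    simp_rw [Finset.card_filter]
    rw [Finset.sum_comm]
    refine Finset.sum_congr rfl fun τ hτ => ?_
    rw [← Finset.card_filter]
    refine Finset.card_nbij' (fun z => τ⁻¹ z) (fun x => τ x) ?_ ?_ ?_ ?_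
    · intro z hz
      simp only [Finset.coe_filter, Set.mem_ofPred_eq] at hz
      exact hz.2
    · intro x hx
      simp only [Finset.coe_filter, Set.mem_ofPred_eq]
      exact ⟨apply_mem_of_mem_permsOfFinset hτ (hA hx), by simpa using hx⟩
    · intro z _
      simp
    · intro x _
      simp
  have h2 : ∀ z ∈ W, ((permsOfFinset W).filter fun τ => τ⁻¹ z ∈ A).card =
      ((permsOfFinset W).filter fun τ => τ⁻¹ y ∈ A).card := by
    intro z hz
    have := card_filter_inv_apply_perm (swap_mem_permsOfFinset hy hz) A y y
    simpa using this
  rw [Finset.sum_congr rfl h2, Finset.sum_const, Finset.sum_const, card_perms_of_finset,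
    smul_eq_mul, smul_eq_mul] at h1
  have h3 : (W.card : ℝ) * ((permsOfFinset W).filter fun τ => τ⁻¹ y ∈ A).card =
      (W.card).factorial * A.card := by exact_mod_cast h1
  field_simp
  linarith

theorem card_filter_inv_apply_pair {W A : Finset ℕ} (hA : A ⊆ W) {y z : ℕ} (hy : y ∈ W)
    (hz : z ∈ W) (hyz : y ≠ z) :
    (((permsOfFinset W).filter fun τ => τ⁻¹ y ∈ A ∧ τ⁻¹ z ∈ A).card : ℝ) =
      (W.card).factorial * (A.card * (A.card - 1) / (W.card * (W.card - 1))) := by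
  have hW : 1 < W.card := Finset.one_lt_card.2 ⟨y, hy, z, hz, hyz⟩
  have h1 : ∑ p ∈ W.offDiag, ((permsOfFinset W).filter fun τ => τ⁻¹ p.1 ∈ A ∧ τ⁻¹ p.2 ∈ A).card =
      ∑ τ ∈ permsOfFinset W, A.offDiag.card := by
    simp_rw [Finset.card_filter]
    rw [Finset.sum_comm]
    refine Finset.sum_congr rfl fun τ hτ => ?_
    rw [← Finset.card_filter]
    refine Finset.card_nbij' (fun z => (τ⁻¹ z.1, τ⁻¹ z.2)) (fun x => (τ x.1, τ x.2)) ?_ ?_ ?_ ?_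
    · rintro ⟨u, w⟩ hz
      simp only [Finset.coe_filter, Set.mem_ofPred_eq, Finset.mem_offDiag] at hz
      simp only [Finset.mem_coe, Finset.mem_offDiag]
      exact ⟨hz.2.1, hz.2.2, by simpa using hz.1.2.2⟩
    · rintro ⟨u, w⟩ hx
      simp only [Finset.mem_coe, Finset.mem_offDiag] at hx
      simp only [Finset.coe_filter, Set.mem_ofPred_eq, Finset.mem_offDiag]
      exact ⟨⟨apply_mem_of_mem_permsOfFinset hτ (hA hx.1),
        apply_mem_of_mem_permsOfFinset hτ (hA hx.2.1), by simpa using hx.2.2⟩,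
        by simpa using hx.1, by simpa using hx.2.1⟩
    · rintro ⟨u, w⟩ _
      simp
    · rintro ⟨u, w⟩ _
      simp
  have h2 : ∀ p ∈ W.offDiag,
      ((permsOfFinset W).filter fun τ => τ⁻¹ p.1 ∈ A ∧ τ⁻¹ p.2 ∈ A).card =
      ((permsOfFinset W).filter fun τ => τ⁻¹ y ∈ A ∧ τ⁻¹ z ∈ A).card := by
    rintro ⟨u, w⟩ hp
    rw [Finset.mem_offDiag] at hp
    obtain ⟨π, hπ, rfl, rfl⟩ := exists_perm_apply_pair hy hz hyz hp.1 hp.2.1 hp.2.2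
    exact card_filter_inv_apply_perm hπ A y z
  have hoff : ∀ B : Finset ℕ, (B.offDiag.card : ℝ) = B.card * (B.card - 1) := by
    intro B
    rw [Finset.offDiag_card, Nat.cast_sub (Nat.le_mul_self _)]
    push_cast
    ring
  rw [Finset.sum_congr rfl h2, Finset.sum_const, Finset.sum_const, card_perms_of_finset,
    smul_eq_mul, smul_eq_mul] at h1
  have h3 : (W.offDiag.card : ℝ) *
      ((permsOfFinset W).filter fun τ => τ⁻¹ y ∈ A ∧ τ⁻¹ z ∈ A).card =
      (W.card).factorial * A.offDiag.card := by exact_mod_cast h1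
  rw [hoff, hoff] at h3
  have hW' : (1 : ℝ) < W.card := by exact_mod_cast hW
  have h4 : (W.card : ℝ) * (W.card - 1) ≠ 0 := (mul_pos (by linarith) (by linarith)).ne'
  rw [← mul_div_assoc, eq_div_iff h4]
  linarith

theorem card_layerSet (W : Finset ℕ) : ((layerSet W).card : ℝ) = ((W.card).factorial : ℝ) ^ 2 := by
  simp [layerSet, card_perms_of_finset]

/-- The two layers are independent: an event that constrains each layer separately is counted by
a product. -/
theorem card_filter_layerSet (W : Finset ℕ) (p : Fin 2 → Equiv.Perm ℕ → Prop)
    [∀ m, DecidablePred (p m)] :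
    ((layerSet W).filter fun τ => ∀ m, p m (τ m)).card =
      ∏ m, ((permsOfFinset W).filter (p m)).card := by
  rw [← Fintype.card_piFinset]
  congr 1
  ext τ
  simp [layerSet, Fintype.mem_piFinset, forall_and]

/-- The number of points `x` of `U` whose preimage under `τ m` of the position `y m x` lies
in `A` for both `m`. With `A` the complement of the current sphere, these are the unexplored peers
that receive no edge from the sphere. -/
def missed (A U : Finset ℕ) (y : Fin 2 → ℕ → ℕ) (τ : Layers) : ℕ :=
  (U.filter fun x => ∀ m, (τ m)⁻¹ (y m x) ∈ A).card

section missed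

variable {W A U : Finset ℕ} {y : Fin 2 → ℕ → ℕ}

theorem sum_missed (hA : A ⊆ W) (hy : ∀ m, ∀ x ∈ U, y m x ∈ W) :
    ∑ τ ∈ layerSet W, (missed A U y τ : ℝ) =
      (layerSet W).card * (U.card * (A.card / W.card) ^ 2) := by
  have h1 : ∑ τ ∈ layerSet W, missed A U y τ =
      ∑ x ∈ U, ((layerSet W).filter fun τ => ∀ m, (τ m)⁻¹ (y m x) ∈ A).card := by
    simp_rw [missed, Finset.card_filter]
    rw [Finset.sum_comm]
  have h2 : ∀ x ∈ U, (((layerSet W).filter fun τ => ∀ m, (τ m)⁻¹ (y m x) ∈ A).card : ℝ) =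
      (layerSet W).card * (A.card / W.card) ^ 2 := by
    intro x hx
    rw [card_filter_layerSet W fun m σ => σ⁻¹ (y m x) ∈ A, Nat.cast_prod,
      Finset.prod_congr rfl fun m _ => card_filter_inv_apply hA (hy m x hx), card_layerSet]
    simp
    ring
  rw [← Nat.cast_sum, h1, Nat.cast_sum, Finset.sum_congr rfl h2]
  simp
  ring

theorem sum_missed_sq (hA : A ⊆ W) (hy : ∀ m, ∀ x ∈ U, y m x ∈ W)
    (hinj : ∀ m, Set.InjOn (y m) U) :
    ∑ τ ∈ layerSet W, (missed A U y τ : ℝ) ^ 2 =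
      (layerSet W).card * (U.card * (A.card / W.card) ^ 2 +
        U.card * (U.card - 1) * (A.card * (A.card - 1) / (W.card * (W.card - 1))) ^ 2) := by
  have h1 : ∑ τ ∈ layerSet W, missed A U y τ ^ 2 =
      ∑ p ∈ U ×ˢ U, ((layerSet W).filter fun τ =>
        ∀ m, (τ m)⁻¹ (y m p.1) ∈ A ∧ (τ m)⁻¹ (y m p.2) ∈ A).card := by
    simp_rw [Finset.card_filter]
    rw [Finset.sum_comm]
    refine Finset.sum_congr rfl fun τ _ => ?_
    rw [← Finset.card_filter, missed, sq, ← Finset.card_product]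
    congr 1
    ext ⟨u, w⟩
    simp only [Finset.mem_product, Finset.mem_filter, forall_and]
    tauto
  have h2 : ∀ p ∈ U.diag, (((layerSet W).filter fun τ =>
      ∀ m, (τ m)⁻¹ (y m p.1) ∈ A ∧ (τ m)⁻¹ (y m p.2) ∈ A).card : ℝ) =
      (layerSet W).card * (A.card / W.card) ^ 2 := by
    rintro ⟨x, x'⟩ hp
    obtain ⟨hx, hxx⟩ := Finset.mem_diag.1 hp
    simp only at hx hxx
    subst hxx
    simp only [and_self]
    rw [card_filter_layerSet W fun m σ => σ⁻¹ (y m x) ∈ A, Nat.cast_prod,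
      Finset.prod_congr rfl fun m _ => card_filter_inv_apply hA (hy m x hx), card_layerSet]
    simp
    ring
  have h3 : ∀ p ∈ U.offDiag, (((layerSet W).filter fun τ =>
      ∀ m, (τ m)⁻¹ (y m p.1) ∈ A ∧ (τ m)⁻¹ (y m p.2) ∈ A).card : ℝ) =
      (layerSet W).card * (A.card * (A.card - 1) / (W.card * (W.card - 1))) ^ 2 := by
    rintro ⟨x, x'⟩ hp
    obtain ⟨hx, hx', hne⟩ := Finset.mem_offDiag.1 hp
    simp only at hx hx' hne
    rw [card_filter_layerSet W fun m σ => σ⁻¹ (y m x) ∈ A ∧ σ⁻¹ (y m x') ∈ A, Nat.cast_prod,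
      Finset.prod_congr rfl fun m _ => card_filter_inv_apply_pair hA (hy m x hx) (hy m x' hx')
        fun h => hne (hinj m hx hx' h), card_layerSet]
    simp
    ring
  have hoff : (U.offDiag.card : ℝ) = U.card * (U.card - 1) := by
    rw [Finset.offDiag_card, Nat.cast_sub (Nat.le_mul_self _)]
    push_cast
    ring
  have h4 : ∑ τ ∈ layerSet W, (missed A U y τ : ℝ) ^ 2 =
      ((∑ τ ∈ layerSet W, missed A U y τ ^ 2 : ℕ) : ℝ) := by push_cast; rfl
  rw [h4, h1, Nat.cast_sum, ← Finset.diag_union_offDiag,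
    Finset.sum_union (Finset.disjoint_diag_offDiag U), Finset.sum_congr rfl h2,
    Finset.sum_congr rfl h3, Finset.sum_const, Finset.sum_const, nsmul_eq_mul, nsmul_eq_mul, hoff,
    Finset.diag_card]
  ring

/-- The variance of the number of missed points, in closed form on the left, is of the order of
the square of the number of draws divided by the number of targets: the terms of order `n` in
the variance of the indicators and in their covariances cancel. -/
theorem missed_variance_le {M a : ℝ} (hM : 1 < M) (ha : 0 ≤ a) (haM : a ≤ M) :
    a * (a / M) ^ 2 + a * (a - 1) * (a * (a - 1) / (M * (M - 1))) ^ 2 - (a * (a / M) ^ 2) ^ 2 ≤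
      3 * (M - a) ^ 2 / (M - 1) := by
  have hk : 0 < M - 1 := by linarith
  have hM0 : 0 < M := by linarith
  have h1 : a * (a / M) ^ 2 + a * (a - 1) * (a * (a - 1) / (M * (M - 1))) ^ 2
      - (a * (a / M) ^ 2) ^ 2 =
      a ^ 3 / M ^ 2 * (3 * (M - a) ^ 2 / ((M - 1) * M)
        - (M - a) ^ 3 * (1 / (M - 1) ^ 2 - 1 / M ^ 2)) := by
    field_simp
    ring
  have h2 : 0 ≤ (M - a) ^ 3 * (1 / (M - 1) ^ 2 - 1 / M ^ 2) := by
    refine mul_nonneg (pow_nonneg (by linarith) 3) (sub_nonneg.2 ?_)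
    refine one_div_le_one_div_of_le (by positivity) ?_
    exact pow_le_pow_left₀ hk.le (by linarith) 2
  have h3 : a ^ 3 / M ^ 2 ≤ M := by
    rw [div_le_iff₀ (by positivity)]
    calc a ^ 3 ≤ M ^ 3 := pow_le_pow_left₀ ha haM 3
      _ = M * M ^ 2 := by ring
  rw [h1]
  calc a ^ 3 / M ^ 2 * (3 * (M - a) ^ 2 / ((M - 1) * M)
        - (M - a) ^ 3 * (1 / (M - 1) ^ 2 - 1 / M ^ 2))
      ≤ a ^ 3 / M ^ 2 * (3 * (M - a) ^ 2 / ((M - 1) * M)) :=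
        mul_le_mul_of_nonneg_left (by linarith) (by positivity)
    _ ≤ M * (3 * (M - a) ^ 2 / ((M - 1) * M)) :=
        mul_le_mul_of_nonneg_right h3 (by positivity)
    _ = 3 * (M - a) ^ 2 / (M - 1) := by field_simp

/-- Chebyshev's inequality for the number of points of `U` that are hit. -/
theorem card_filter_hit_lt (hA : A ⊆ W) (hU : U.card = A.card)
    (hy : ∀ m, ∀ x ∈ U, y m x ∈ W) (hinj : ∀ m, Set.InjOn (y m) U) (hW : 1 < W.card)
    {b t : ℝ} (ht : 0 < t)
    (hb : b + t ≤ A.card - A.card * ((A.card : ℝ) / W.card) ^ 2) :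
    (((layerSet W).filter fun τ => (U.card : ℝ) - missed A U y τ < b).card : ℝ) ≤
      (layerSet W).card * (3 * ((W.card : ℝ) - A.card) ^ 2 / ((W.card - 1) * t ^ 2)) := by
  set a : ℝ := (A.card : ℝ) with ha
  set M : ℝ := (W.card : ℝ) with hMW
  have hM : 1 < M := by rw [hMW]; exact_mod_cast hW
  have haM : a ≤ M := by rw [ha, hMW]; exact_mod_cast Finset.card_le_card hA
  have hsum : ∑ τ ∈ layerSet W, ((missed A U y τ : ℝ) - a * (a / M) ^ 2) ^ 2 ≤
      (layerSet W).card * (3 * (M - a) ^ 2 / (M - 1)) := by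
    have h1 : ∑ τ ∈ layerSet W, ((missed A U y τ : ℝ) - a * (a / M) ^ 2) ^ 2 =
        ∑ τ ∈ layerSet W, (missed A U y τ : ℝ) ^ 2
          - 2 * (a * (a / M) ^ 2) * ∑ τ ∈ layerSet W, (missed A U y τ : ℝ)
          + (layerSet W).card * (a * (a / M) ^ 2) ^ 2 := by
      have hconst : (layerSet W).card * (a * (a / M) ^ 2) ^ 2 =
          ∑ τ ∈ layerSet W, (a * (a / M) ^ 2) ^ 2 := by
        rw [Finset.sum_const, nsmul_eq_mul]
      rw [Finset.mul_sum, ← Finset.sum_sub_distrib, hconst, ← Finset.sum_add_distrib]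
      exact Finset.sum_congr rfl fun τ _ => by ring
    rw [h1, sum_missed_sq hA hy hinj, sum_missed hA hy, hU]
    have h2 := missed_variance_le hM (Nat.cast_nonneg A.card) haM
    refine le_trans (le_of_eq ?_) (mul_le_mul_of_nonneg_left h2 (Nat.cast_nonneg _))
    ring
  have hbad : (((layerSet W).filter fun τ => (U.card : ℝ) - missed A U y τ < b).card : ℝ) * t ^ 2 ≤
      ∑ τ ∈ layerSet W, ((missed A U y τ : ℝ) - a * (a / M) ^ 2) ^ 2 := by
    rw [← nsmul_eq_mul, ← Finset.sum_const]
    refine le_trans (Finset.sum_le_sum fun τ hτ => ?_)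
      (Finset.sum_le_sum_of_subset_of_nonneg (Finset.filter_subset _ _) fun _ _ _ => sq_nonneg _)
    have h1 := (Finset.mem_filter.1 hτ).2
    rw [hU] at h1
    exact pow_le_pow_left₀ ht.le (by linarith) 2
  rw [← div_div, ← mul_div_assoc, le_div_iff₀ (by positivity)]
  exact hbad.trans hsum

/-- At most `2 * |W \ A|` points are hit, since each layer hits one point for each point of
`W \ A`. -/
theorem card_sub_missed_le (hA : A ⊆ W)
    (hy : ∀ m, ∀ x ∈ U, y m x ∈ W) (hinj : ∀ m, Set.InjOn (y m) U) {τ : Layers}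
    (hτ : τ ∈ layerSet W) : U.card ≤ missed A U y τ + 2 * (W.card - A.card) := by
  have h1 : U ⊆ (U.filter fun x => ∀ m, (τ m)⁻¹ (y m x) ∈ A) ∪
      Finset.univ.biUnion fun m => U.filter fun x => (τ m)⁻¹ (y m x) ∈ W \ A := by
    intro x hx
    by_cases h : ∀ m, (τ m)⁻¹ (y m x) ∈ A
    · exact Finset.mem_union_left _ (Finset.mem_filter.2 ⟨hx, h⟩)
    · push Not at h
      obtain ⟨m, hm⟩ := h
      refine Finset.mem_union_right _ (Finset.mem_biUnion.2 ⟨m, Finset.mem_univ m, ?_⟩)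
      rw [Finset.mem_filter, Finset.mem_sdiff]
      exact ⟨hx, apply_mem_of_mem_permsOfFinset
        (inv_mem_permsOfFinset (Fintype.mem_piFinset.1 hτ m)) (hy m x hx), hm⟩
  have h2 : ∀ m, (U.filter fun x => (τ m)⁻¹ (y m x) ∈ W \ A).card ≤ W.card - A.card := by
    intro m
    rw [← Finset.card_sdiff_of_subset hA]
    refine Finset.card_le_card_of_injOn (fun x => (τ m)⁻¹ (y m x)) ?_ ?_
    · intro x hx
      exact (Finset.mem_filter.1 hx).2
    · intro x hx x' hx' h
      exact hinj m (Finset.mem_filter.1 hx).1 (Finset.mem_filter.1 hx').1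
        ((τ m)⁻¹.injective h)
  refine (Finset.card_le_card h1).trans ((Finset.card_union_le _ _).trans ?_)
  refine Nat.add_le_add_left (Finset.card_biUnion_le.trans ?_) _
  refine (Finset.sum_le_sum fun m _ => h2 m).trans ?_
  simp

/-- Markov's inequality for the number of collisions among the `2 * |W \ A|` hits. -/
theorem card_filter_hit_lt_two_mul (hA : A ⊆ W) (hU : U.card = A.card)
    (hy : ∀ m, ∀ x ∈ U, y m x ∈ W) (hinj : ∀ m, Set.InjOn (y m) U) (hW : 0 < W.card) :
    (((layerSet W).filter fun τ =>
        (U.card : ℝ) - missed A U y τ < 2 * ((W.card : ℝ) - A.card)).card : ℝ) ≤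
      (layerSet W).card * (3 * ((W.card : ℝ) - A.card) ^ 2 / W.card) := by
  have hM : (0 : ℝ) < W.card := by exact_mod_cast hW
  have haM : (A.card : ℝ) ≤ W.card := by exact_mod_cast Finset.card_le_card hA
  have hle : ∀ τ ∈ layerSet W, (U.card : ℝ) ≤ missed A U y τ + 2 * ((W.card : ℝ) - A.card) := by
    intro τ hτ
    have h := card_sub_missed_le hA hy hinj hτ
    rw [← Nat.cast_sub (Finset.card_le_card hA)]
    exact_mod_cast h
  have h1 : (((layerSet W).filter fun τ =>
      (U.card : ℝ) - missed A U y τ < 2 * ((W.card : ℝ) - A.card)).card : ℝ) ≤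
      ∑ τ ∈ layerSet W, (missed A U y τ + 2 * ((W.card : ℝ) - A.card) - U.card) := by
    rw [← mul_one (Finset.card _ : ℝ), ← nsmul_eq_mul, ← Finset.sum_const]
    refine le_trans (Finset.sum_le_sum fun τ hτ => ?_)
      (Finset.sum_le_sum_of_subset_of_nonneg (Finset.filter_subset _ _) fun τ hτ _ => ?_)
    · have h2 := (Finset.mem_filter.1 hτ).2
      -- the number of collisions is an integer, so it is at least `1` when positive
      rw [← Nat.cast_sub (Finset.card_le_card hA)] at h2 ⊢
      have h3 : U.card + 1 ≤ missed A U y τ + 2 * (W.card - A.card) := by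
        have h4 : (U.card : ℝ) < missed A U y τ + 2 * ((W.card - A.card : ℕ) : ℝ) := by linarith
        exact_mod_cast h4
      have h5 : (U.card : ℝ) + 1 ≤ missed A U y τ + 2 * ((W.card - A.card : ℕ) : ℝ) := by
        exact_mod_cast h3
      linarith
    · linarith [hle τ hτ]
  refine h1.trans ?_
  rw [Finset.sum_sub_distrib, Finset.sum_add_distrib, sum_missed hA hy, Finset.sum_const,
    Finset.sum_const, nsmul_eq_mul, nsmul_eq_mul, hU, add_comm, ← mul_add, ← mul_sub]
  refine mul_le_mul_of_nonneg_left ?_ (Nat.cast_nonneg _)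
  have h6 : 2 * ((W.card : ℝ) - A.card) + A.card * ((A.card : ℝ) / W.card) ^ 2 - A.card =
      3 * ((W.card : ℝ) - A.card) ^ 2 / W.card - ((W.card : ℝ) - A.card) ^ 3 / W.card ^ 2 := by
    field_simp
    ring
  rw [h6]
  have : 0 ≤ ((W.card : ℝ) - A.card) ^ 3 / W.card ^ 2 :=
    div_nonneg (pow_nonneg (by linarith) 3) (by positivity)
  linarith

end missed

/-! ### Exploring the layers by distance from the source -/

section exploration

open scoped Classical

/-- The peers at depth less than `d`. -/
noncomputable def ball (V : Finset ℕ) (c : Layers) (d : ℕ) : Finset ℕ :=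
  V.filter fun v => ∃ k < d, ReachIn c k v

/-- The peers at depth `d`. -/
noncomputable def sphere (V : Finset ℕ) (c : Layers) (d : ℕ) : Finset ℕ :=
  V.filter fun v => IsDepth c d v

theorem isDepth_iff {c : Layers} {d v : ℕ} :
    IsDepth c d v ↔ ReachIn c d v ∧ ¬ ∃ k < d, ReachIn c k v := by
  simp [IsDepth]

theorem exists_isDepth_iff {c : Layers} {d v : ℕ} :
    (∃ k < d, IsDepth c k v) ↔ ∃ k < d, ReachIn c k v := by
  constructor
  · rintro ⟨k, hk, h⟩
    exact ⟨k, hk, h.1⟩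
  · rintro ⟨k, hk, h⟩
    have hex : ∃ k, ReachIn c k v := ⟨k, h⟩
    exact ⟨Nat.find hex, (Nat.find_min' hex h).trans_lt hk, Nat.find_spec hex,
      fun j hj => Nat.find_min hex hj⟩

theorem numDepth_eq (V : Finset ℕ) (c : Layers) (d : ℕ) :
    numDepth V c d = (sphere V c d).card := rfl

theorem numFrom_eq (V : Finset ℕ) (c : Layers) (d : ℕ) :
    numFrom V c d = (V \ ball V c d).card := by
  unfold numFrom
  congr 1
  ext v
  simp only [Finset.mem_filter, Finset.mem_sdiff, ball, ← exists_isDepth_iff]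
  push Not
  tauto

theorem mem_ball_succ {V : Finset ℕ} {c : Layers} {d v : ℕ} :
    v ∈ ball V c (d + 1) ↔ v ∈ ball V c d ∨ v ∈ sphere V c d := by
  simp only [ball, sphere, Finset.mem_filter, isDepth_iff, Nat.lt_succ_iff_lt_or_eq]
  constructor
  · rintro ⟨hv, k, hk | rfl, h⟩
    · exact Or.inl ⟨hv, k, hk, h⟩
    · by_cases h' : ∃ j < k, ReachIn c j v
      · exact Or.inl ⟨hv, h'⟩
      · exact Or.inr ⟨hv, h, h'⟩
  · rintro (⟨hv, k, hk, h⟩ | ⟨hv, h, -⟩)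
    · exact ⟨hv, k, Or.inl hk, h⟩
    · exact ⟨hv, d, Or.inr rfl, h⟩

theorem sphere_subset (V : Finset ℕ) (c : Layers) (d : ℕ) :
    sphere V c d ⊆ V \ ball V c d := by
  intro v hv
  simp only [sphere, ball, Finset.mem_filter, Finset.mem_sdiff, isDepth_iff] at hv ⊢
  exact ⟨hv.1, fun h => hv.2.2 h.2⟩

theorem sdiff_ball_succ (V : Finset ℕ) (c : Layers) (d : ℕ) :
    V \ ball V c (d + 1) = (V \ ball V c d) \ sphere V c d := by
  ext v
  simp only [Finset.mem_sdiff, mem_ball_succ]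
  tauto

theorem numFrom_succ_add (V : Finset ℕ) (c : Layers) (d : ℕ) :
    numFrom V c (d + 1) + numDepth V c d = numFrom V c d := by
  rw [numFrom_eq, numFrom_eq, numDepth_eq, sdiff_ball_succ,
    Finset.card_sdiff_add_card_eq_card (sphere_subset V c d)]

theorem ReachIn.mem {V : Finset ℕ} {c : Layers} (hs : source ∈ V) (hc : c ∈ layerSet V) :
    ∀ {k v : ℕ}, ReachIn c k v → v ∈ V
  | 0, _, h => by rw [show _ = source from h]; exact hs
  | _ + 1, _, ⟨_, hu, m, hm⟩ => by
    rw [← hm]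
    exact apply_mem_of_mem_permsOfFinset (Fintype.mem_piFinset.1 hc m) (ReachIn.mem hs hc hu)

/-- The walks of length at most `d` are determined by the edges leaving the peers of depth less
than `d`. -/
theorem reachIn_congr {V : Finset ℕ} {c c' : Layers} {d : ℕ} (hs : source ∈ V)
    (hc : c ∈ layerSet V) (h : ∀ m, ∀ x ∈ ball V c d, c' m x = c m x) :
    ∀ k ≤ d, ∀ v, ReachIn c' k v ↔ ReachIn c k v := by
  intro k
  induction k with
  | zero => exact fun _ _ => Iff.rfl
  | succ k ih =>
    intro hk v
    refine exists_congr fun u => ?_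
    rw [ih (by omega) u]
    refine and_congr_right fun hu => exists_congr fun m => ?_
    rw [h m u (Finset.mem_filter.2 ⟨hu.mem hs hc, k, by omega, hu⟩)]

theorem ball_congr {V : Finset ℕ} {c c' : Layers} {d : ℕ} (hs : source ∈ V)
    (hc : c ∈ layerSet V) (h : ∀ m, ∀ x ∈ ball V c d, c' m x = c m x) {k : ℕ} (hk : k ≤ d + 1) :
    ball V c' k = ball V c k := by
  ext v
  simp only [ball, Finset.mem_filter]
  refine and_congr_right fun _ => exists_congr fun j => and_congr_right fun hj => ?_
  exact reachIn_congr hs hc h j (by omega) v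

theorem sphere_congr {V : Finset ℕ} {c c' : Layers} {d : ℕ} (hs : source ∈ V)
    (hc : c ∈ layerSet V) (h : ∀ m, ∀ x ∈ ball V c d, c' m x = c m x) {k : ℕ} (hk : k ≤ d) :
    sphere V c' k = sphere V c k := by
  have h1 := ball_congr hs hc h (k := k) (by omega)
  have h2 := ball_congr hs hc h (k := k + 1) (by omega)
  have h3 : ∀ b : Layers, sphere V b k = ball V b (k + 1) \ ball V b k := by
    intro b
    ext v
    have := sphere_subset V b k
    rw [Finset.mem_sdiff, mem_ball_succ]
    constructor
    · intro hv
      exact ⟨Or.inr hv, (Finset.mem_sdiff.1 (this hv)).2⟩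
    · rintro ⟨h | h, h'⟩
      · exact absurd h h'
      · exact h
  rw [h3, h3, h1, h2]

/-- What is known of the layers once all edges leaving the peers of depth less than `d` have been
revealed: the set of these peers and the children of each of them (with the placeholder `0` as
children of the other peers). -/
noncomputable def history (V : Finset ℕ) (d : ℕ) (c : Layers) :
    Finset ℕ × (Fin 2 → ℕ → ℕ) :=
  (ball V c d, fun m x => if x ∈ ball V c d then c m x else 0)

theorem history_eq_iff {V : Finset ℕ} {c c' : Layers} {d : ℕ} (hs : source ∈ V)
    (hc : c ∈ layerSet V) :
    history V d c' = history V d c ↔ ∀ m, ∀ x ∈ ball V c d, c' m x = c m x := by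
  constructor
  · intro h m x hx
    have h1 : ball V c' d = ball V c d := congrArg Prod.fst h
    have h2 := congrFun (congrFun (congrArg Prod.snd h) m) x
    simpa [history, h1, hx] using h2
  · intro h
    have h1 : ball V c' d = ball V c d := ball_congr hs hc h (by omega)
    refine Prod.ext h1 ?_
    funext m x
    simp only [history, h1]
    by_cases hx : x ∈ ball V c d
    · simp [hx, h m x hx]
    · simp [hx]

/-- Given the history, the remaining edges are those of two uniform bijections from the peers
not yet explored to the remaining targets. -/
theorem card_filter_history {V : Finset ℕ} {c : Layers} {d : ℕ} (hs : source ∈ V)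
    (hc : c ∈ layerSet V) (p : Layers → Prop) :
    ((layerSet V).filter fun c' => history V d c' = history V d c ∧ p c').card =
      ((layerSet (V \ ball V c d)).filter fun τ => p (c * τ)).card := by
  have hcm : ∀ m, c m ∈ permsOfFinset V := fun m => Fintype.mem_piFinset.1 hc m
  refine Finset.card_nbij' (fun c' => c⁻¹ * c') (fun τ => c * τ) ?_ ?_ ?_ ?_
  · intro c' hc'
    simp only [Finset.coe_filter, Set.mem_ofPred_eq, history_eq_iff hs hc] at hc' ⊢
    refine ⟨mem_layerSet.2 fun m x hx => ?_, by simpa using hc'.2.2⟩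
    rw [Pi.mul_apply, Pi.inv_apply, Equiv.Perm.mul_apply, Equiv.Perm.inv_eq_iff_eq]
    by_cases hxV : x ∈ V
    · have hxb : x ∈ ball V c d := by
        by_contra h
        exact hx (Finset.mem_sdiff.2 ⟨hxV, h⟩)
      exact hc'.2.1 m x hxb
    · rw [mem_layerSet.1 hc'.1 m x hxV, mem_layerSet.1 hc m x hxV]
  · intro τ hτ
    simp only [Finset.coe_filter, Set.mem_ofPred_eq, history_eq_iff hs hc] at hτ ⊢
    refine ⟨Fintype.mem_piFinset.2 fun m => mul_mem_permsOfFinset (hcm m)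
      (permsOfFinset_mono Finset.sdiff_subset (Fintype.mem_piFinset.1 hτ.1 m)), ?_, hτ.2⟩
    intro m x hx
    rw [Pi.mul_apply, Equiv.Perm.mul_apply, mem_layerSet.1 hτ.1 m x (by simp [hx])]
  · intro c' _
    simp
  · intro τ _
    simp

theorem inv_apply_mem_sdiff_ball {V : Finset ℕ} {c : Layers} {d : ℕ} (hc : c ∈ layerSet V)
    (m : Fin 2) {x : ℕ} (hx : x ∈ V \ ball V c (d + 1)) : (c m)⁻¹ x ∈ V \ ball V c d := by
  obtain ⟨hxV, hxb⟩ := Finset.mem_sdiff.1 hx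
  refine Finset.mem_sdiff.2 ⟨apply_mem_of_mem_permsOfFinset
    (inv_mem_permsOfFinset (Fintype.mem_piFinset.1 hc m)) hxV, fun h => hxb ?_⟩
  obtain ⟨-, k, hk, hr⟩ := Finset.mem_filter.1 h
  exact Finset.mem_filter.2 ⟨hxV, k + 1, by omega, (c m)⁻¹ x, hr, m, by simp⟩

/-- The next sphere consists of the unexplored peers that are not missed by the edges leaving the
current sphere. -/
theorem numDepth_succ_add_missed {V : Finset ℕ} {c τ : Layers} {d : ℕ} (hs : source ∈ V)
    (hc : c ∈ layerSet V) (hτ : τ ∈ layerSet (V \ ball V c d)) :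
    numDepth V (c * τ) (d + 1) + missed (V \ ball V c (d + 1)) (V \ ball V c (d + 1))
      (fun m x => (c m)⁻¹ x) τ = (V \ ball V c (d + 1)).card := by
  have hagree : ∀ m, ∀ x ∈ ball V c d, (c * τ) m x = c m x := by
    intro m x hx
    rw [Pi.mul_apply, Equiv.Perm.mul_apply, mem_layerSet.1 hτ m x (by simp [hx])]
  have hsphere : sphere V (c * τ) (d + 1) = (V \ ball V c (d + 1)).filter fun x =>
      ¬ ∀ m, (τ m)⁻¹ ((c m)⁻¹ x) ∈ V \ ball V c (d + 1) := by
    ext x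
    have hb := ball_congr hs hc hagree (k := d + 1) le_rfl
    have h1 : x ∈ sphere V (c * τ) (d + 1) ↔
        x ∈ V \ ball V c (d + 1) ∧ ReachIn (c * τ) (d + 1) x := by
      rw [← hb]
      simp only [sphere, ball, isDepth_iff, Finset.mem_filter, Finset.mem_sdiff]
      exact ⟨fun h => ⟨⟨h.1, fun h' => h.2.2 h'.2⟩, h.2.1⟩,
        fun h => ⟨h.1.1, h.2, fun h' => h.1.2 ⟨h.1.1, h'⟩⟩⟩
    rw [h1, Finset.mem_filter]
    refine and_congr_right fun hx => ?_
    have hz : ∀ m, (τ m)⁻¹ ((c m)⁻¹ x) ∉ V \ ball V c (d + 1) ↔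
        ReachIn c d ((τ m)⁻¹ ((c m)⁻¹ x)) := by
      intro m
      have hzW : (τ m)⁻¹ ((c m)⁻¹ x) ∈ V \ ball V c d :=
        apply_mem_of_mem_permsOfFinset
          (inv_mem_permsOfFinset (Fintype.mem_piFinset.1 hτ m)) (inv_apply_mem_sdiff_ball hc m hx)
      rw [sdiff_ball_succ, Finset.mem_sdiff, not_and_not_right]
      simp only [hzW, forall_true_left]
      simp only [sphere, ball, isDepth_iff, Finset.mem_filter, Finset.mem_sdiff] at hzW ⊢
      tauto
    push Not
    simp only [hz]
    constructor
    · rintro ⟨u, hu, m, rfl⟩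
      refine ⟨m, ?_⟩
      rw [reachIn_congr hs hc hagree d le_rfl] at hu
      simpa using hu
    · rintro ⟨m, hm⟩
      refine ⟨_, (reachIn_congr hs hc hagree d le_rfl _).2 hm, m, ?_⟩
      simp
  rw [numDepth_eq, hsphere, missed, add_comm, Finset.card_filter_add_card_filter_not]

variable {V : Finset ℕ} {c : Layers} {d : ℕ}

theorem card_sdiff_ball_succ (V : Finset ℕ) (c : Layers) (d : ℕ) :
    ((V \ ball V c (d + 1)).card : ℝ) = numFrom V c d - numDepth V c d := by
  rw [← numFrom_eq, ← numFrom_succ_add V c d]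
  push_cast
  ring

theorem sdiff_ball_succ_subset (V : Finset ℕ) (c : Layers) (d : ℕ) :
    V \ ball V c (d + 1) ⊆ V \ ball V c d := by
  rw [sdiff_ball_succ]
  exact Finset.sdiff_subset

/-- Given the history up to depth `d`, the number of peers at depth `d + 1` falls short of
`2 * N_d - 3 * N_d ^ 2 / N_{> d-1}` by `t` with probability of the order of
`N_d ^ 2 / (N_{> d-1} * t ^ 2)`. -/
theorem card_filter_numDepth_succ_lt (hs : source ∈ V) (hc : c ∈ layerSet V)
    (hM : 1 < numFrom V c d) {b t : ℝ} (ht : 0 < t)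
    (hb : b + t ≤ 2 * numDepth V c d - 3 * (numDepth V c d : ℝ) ^ 2 / numFrom V c d) :
    (((layerSet V).filter fun c' => history V d c' = history V d c ∧
        (numDepth V c' (d + 1) : ℝ) < b).card : ℝ) ≤
      ((layerSet V).filter fun c' => history V d c' = history V d c).card *
        (3 * (numDepth V c d : ℝ) ^ 2 / (((numFrom V c d : ℝ) - 1) * t ^ 2)) := by
  have hM0 : (0 : ℝ) < numFrom V c d := by exact_mod_cast (by omega : 0 < numFrom V c d)
  have h0 := card_filter_history hs hc (d := d) fun _ => True
  simp only [and_true, Finset.filter_true] at h0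
  rw [card_filter_history hs hc, h0]
  have hA := card_sdiff_ball_succ V c d
  have h1 := card_filter_hit_lt (U := V \ ball V c (d + 1)) (sdiff_ball_succ_subset V c d) rfl
    (y := fun m x => (c m)⁻¹ x) (fun m x hx => inv_apply_mem_sdiff_ball hc m hx)
    (fun m => (c m)⁻¹.injective.injOn) (by rwa [← numFrom_eq]) ht (b := b) (by
      rw [hA, ← numFrom_eq]
      refine hb.trans (le_of_sub_nonneg ?_)
      have h2 : (numFrom V c d : ℝ) - numDepth V c d - (numFrom V c d - numDepth V c d) *
          (((numFrom V c d : ℝ) - numDepth V c d) / numFrom V c d) ^ 2 -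
          (2 * numDepth V c d - 3 * (numDepth V c d : ℝ) ^ 2 / numFrom V c d) =
          (numDepth V c d : ℝ) ^ 3 / (numFrom V c d : ℝ) ^ 2 := by
        field_simp
        ring
      rw [h2]
      positivity)
  rw [hA, ← numFrom_eq, sub_sub_cancel] at h1
  refine le_trans (le_of_eq ?_) h1
  congr 2
  refine Finset.filter_congr fun τ hτ => ?_
  have h3 := numDepth_succ_add_missed hs hc hτ
  rw [← hA, ← h3]
  push_cast
  rw [add_sub_cancel_right]

theorem card_filter_numDepth_succ_lt_two_mul (hs : source ∈ V) (hc : c ∈ layerSet V)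
    (hM : 0 < numFrom V c d) :
    (((layerSet V).filter fun c' => history V d c' = history V d c ∧
        (numDepth V c' (d + 1) : ℝ) < 2 * numDepth V c d).card : ℝ) ≤
      ((layerSet V).filter fun c' => history V d c' = history V d c).card *
        (3 * (numDepth V c d : ℝ) ^ 2 / numFrom V c d) := by
  have h0 := card_filter_history hs hc (d := d) fun _ => True
  simp only [and_true, Finset.filter_true] at h0
  rw [card_filter_history hs hc, h0]
  have hA := card_sdiff_ball_succ V c d
  have h1 := card_filter_hit_lt_two_mul (U := V \ ball V c (d + 1)) (sdiff_ball_succ_subset V c d)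
    rfl (y := fun m x => (c m)⁻¹ x) (fun m x hx => inv_apply_mem_sdiff_ball hc m hx)
    (fun m => (c m)⁻¹.injective.injOn) (by rwa [← numFrom_eq])
  rw [hA, ← numFrom_eq, sub_sub_cancel] at h1
  refine le_trans (le_of_eq ?_) h1
  congr 2
  refine Finset.filter_congr fun τ hτ => ?_
  have h3 := numDepth_succ_add_missed hs hc hτ
  rw [← hA, ← h3]
  push_cast
  rw [add_sub_cancel_right]

theorem numDepth_zero_eq_one (hs : source ∈ V) (c : Layers) : numDepth V c 0 = 1 := by
  rw [numDepth_eq, Finset.card_eq_one]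
  refine ⟨source, ?_⟩
  ext v
  simp only [sphere, IsDepth, Finset.mem_filter, Finset.mem_singleton, ReachIn, not_lt_zero,
    IsEmpty.forall_iff, implies_true, and_true]
  constructor
  · exact fun h => h.2
  · rintro rfl
    exact ⟨hs, rfl⟩

theorem numDepth_succ_le (hs : source ∈ V) (hc : c ∈ layerSet V) :
    numDepth V c (d + 1) ≤ 2 * numDepth V c d := by
  have h1 : (1 : Layers) ∈ layerSet (V \ ball V c d) :=
    Fintype.mem_piFinset.2 fun _ => one_mem_permsOfFinset _
  have h2 := numDepth_succ_add_missed hs hc h1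
  have h3 := card_sub_missed_le (U := V \ ball V c (d + 1)) (sdiff_ball_succ_subset V c d)
    (y := fun m x => (c m)⁻¹ x) (fun m x hx => inv_apply_mem_sdiff_ball hc m hx)
    (fun m => (c m)⁻¹.injective.injOn) h1
  have h4 := numFrom_succ_add V c d
  rw [numFrom_eq, numFrom_eq] at h4
  rw [mul_one] at h2
  omega

theorem numDepth_le_two_pow (hs : source ∈ V) (hc : c ∈ layerSet V) (d : ℕ) :
    numDepth V c d ≤ 2 ^ d := by
  induction d with
  | zero => exact (numDepth_zero_eq_one hs c).le
  | succ d ih =>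
    rw [pow_succ]
    have := numDepth_succ_le hs hc (d := d)
    omega

theorem card_le_numFrom_add_two_pow (hs : source ∈ V) (hc : c ∈ layerSet V) (d : ℕ) :
    V.card ≤ numFrom V c d + 2 ^ d := by
  induction d with
  | zero =>
    have : numFrom V c 0 = V.card := by simp [numFrom]
    omega
  | succ d ih =>
    rw [pow_succ]
    have h1 := numFrom_succ_add V c d
    have h2 := numDepth_le_two_pow hs hc d
    omega

/-- The law of total probability over a finite set of equally likely outcomes. -/
theorem card_filter_le_of_fiberwise {α β : Type*} [DecidableEq β] (s : Finset α) (f : α → β)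
    (p : α → Prop) [DecidablePred p] (q : ℝ) (h : ∀ a ∈ s, ((s.filter fun a' => f a' = f a ∧ p a').card : ℝ) ≤
      (s.filter fun a' => f a' = f a).card * q) :
    ((s.filter p).card : ℝ) ≤ s.card * q := by
  have h1 : (s.filter p).card =
      ∑ b ∈ s.image f, (s.filter fun a' => f a' = b ∧ p a').card := by
    rw [Finset.card_eq_sum_card_fiberwise (f := f) (t := s.image f)
      fun a ha => Finset.mem_image_of_mem f (Finset.mem_filter.1 ha).1]
    refine Finset.sum_congr rfl fun b _ => ?_
    rw [Finset.filter_filter]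
    simp only [and_comm]
  have h2 : s.card = ∑ b ∈ s.image f, (s.filter fun a' => f a' = b).card :=
    Finset.card_eq_sum_card_fiberwise fun a ha => Finset.mem_image_of_mem f ha
  rw [h1, h2, Nat.cast_sum, Nat.cast_sum, Finset.sum_mul]
  refine Finset.sum_le_sum fun b hb => ?_
  obtain ⟨a, ha, rfl⟩ := Finset.mem_image.1 hb
  exact h a ha

end exploration

/-! ### Growth of the spheres -/

section growth

open scoped Classical

/-- The lower bound on the growth factor holds at all depths below `d`. -/
def GrowsUpTo (V : Finset ℕ) (c : Layers) (d : ℕ) : Prop :=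
  ∀ k < d, 2 * growth V c k * (numDepth V c k : ℝ) ≤ (numDepth V c (k + 1) : ℝ)

theorem two_rpow_mul_logb {N : ℕ} (hN : 0 < N) (a : ℝ) :
    (2 : ℝ) ^ (a * Real.logb 2 N) = (N : ℝ) ^ a := by
  rw [mul_comm, Real.rpow_mul (by norm_num),
    Real.rpow_logb (by norm_num) (by norm_num) (by exact_mod_cast hN)]

theorem two_pow_le_of_lt_depthOne {N d : ℕ} (hN : 0 < N) (h : d < depthOne N) :
    (2 : ℝ) ^ d ≤ (N : ℝ) ^ (1 / 3 : ℝ) := by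
  rw [← two_rpow_mul_logb hN, ← Real.rpow_natCast]
  refine Real.rpow_le_rpow_of_exponent_le (by norm_num) ?_
  have := Nat.lt_ceil.1 h
  linarith

theorem two_pow_le_of_lt_depthTwo {N d : ℕ} (hN : 0 < N) (h : d < depthTwo N) :
    (2 : ℝ) ^ d ≤ (N : ℝ) ^ (5 / 6 : ℝ) := by
  rw [← two_rpow_mul_logb hN, ← Real.rpow_natCast]
  refine Real.rpow_le_rpow_of_exponent_le (by norm_num) ?_
  have := Nat.lt_ceil.1 h
  linarith

theorem le_two_pow_of_depthTwo_le {N d : ℕ} (hN : 0 < N) (h : depthTwo N ≤ d) :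
    (N : ℝ) ^ (5 / 6 : ℝ) ≤ (2 : ℝ) ^ d := by
  rw [← two_rpow_mul_logb hN, ← Real.rpow_natCast]
  refine Real.rpow_le_rpow_of_exponent_le (by norm_num) ?_
  have := Nat.ceil_le.1 h
  linarith

variable {V : Finset ℕ} {c : Layers} {d : ℕ}

theorem half_card_le_numFrom_sub_one (hs : source ∈ V) (hc : c ∈ layerSet V) (hN : 4 ≤ V.card)
    (h4 : 4 * 2 ^ d ≤ V.card) : (V.card : ℝ) / 2 ≤ numFrom V c d - 1 := by
  have h1 := card_le_numFrom_add_two_pow hs hc d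
  have h2 : V.card + 2 ≤ 2 * numFrom V c d := by omega
  have h3 : (V.card : ℝ) + 2 ≤ 2 * numFrom V c d := by exact_mod_cast h2
  linarith

/-- The fraction `N_d / N_{> d-1}` is small as long as `2 ^ d` is small compared with `|V|`. -/
theorem numDepth_div_numFrom_le (hs : source ∈ V) (hc : c ∈ layerSet V) (hN : 4 ≤ V.card)
    (h4 : 4 * 2 ^ d ≤ V.card) :
    (numDepth V c d : ℝ) / numFrom V c d ≤ 2 * 2 ^ d / V.card := by
  have h1 := half_card_le_numFrom_sub_one hs hc hN h4
  have h2 : (numDepth V c d : ℝ) ≤ 2 ^ d := by exact_mod_cast numDepth_le_two_pow hs hc d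
  have h3 : (0 : ℝ) < V.card := by exact_mod_cast (by omega : 0 < V.card)
  calc (numDepth V c d : ℝ) / numFrom V c d ≤ 2 ^ d / (V.card / 2) :=
        div_le_div₀ (by positivity) h2 (by positivity) (by linarith)
    _ = 2 * 2 ^ d / V.card := by field_simp

theorem one_sub_growth_le (hs : source ∈ V) (hc : c ∈ layerSet V) (hN : 4 ≤ V.card)
    (h4 : 4 * 2 ^ d ≤ V.card) :
    1 - growth V c d ≤ (V.card : ℝ) ^ (-(1 / 9) : ℝ) + 6 * 2 ^ d / V.card := by
  have h0 : (0 : ℝ) ≤ (V.card : ℝ) ^ (-(1 / 9) : ℝ) := by positivity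
  have h1 : (0 : ℝ) ≤ 6 * 2 ^ d / V.card := by positivity
  unfold growth
  split_ifs with h h'
  · linarith
  · linarith
  · have h2 := numDepth_div_numFrom_le hs hc hN h4
    have h3 : (2 : ℝ) * 2 ^ d / V.card ≤ 1 / 2 := by
      have : (4 : ℝ) * 2 ^ d ≤ V.card := by exact_mod_cast h4
      rw [div_le_iff₀ (by exact_mod_cast (by omega : 0 < V.card))]
      linarith
    have h5 : (6 : ℝ) * 2 ^ d / V.card = 3 * (2 * 2 ^ d / V.card) := by ring
    set y : ℝ := (numDepth V c d : ℝ) / numFrom V c d with hy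
    have hy0 : 0 ≤ y := by positivity
    have h6 : 1 - (1 - y) ^ 3 ≤ 3 * y := by
      have : 0 ≤ y ^ 2 * (3 - y) := mul_nonneg (sq_nonneg y) (by linarith)
      linarith [show (1 - y) ^ 3 = 1 - 3 * y + y ^ 2 * (3 - y) by ring]
    linarith

/-- As long as the growth bounds hold, the sphere of radius `d` has nearly `2 ^ d` elements. -/
theorem two_pow_mul_le_numDepth (hs : source ∈ V) (hc : c ∈ layerSet V) (hN : 4 ≤ V.card)
    (h4 : ∀ k < d, 4 * 2 ^ k ≤ V.card) (hg : GrowsUpTo V c d) :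
    (2 : ℝ) ^ d * (1 - (d * (V.card : ℝ) ^ (-(1 / 9) : ℝ) + 6 * 2 ^ d / V.card)) ≤
      numDepth V c d := by
  induction d with
  | zero =>
    rw [numDepth_zero_eq_one hs c]
    have : (0 : ℝ) ≤ 6 * 2 ^ 0 / V.card := by positivity
    simp only [pow_zero, CharP.cast_eq_zero, zero_mul, zero_add, one_mul, Nat.cast_one]
    simp only [pow_zero] at this
    linarith
  | succ d ih =>
    have h1 := ih (fun k hk => h4 k (by omega)) fun k hk => hg k (by omega)
    have h2 := hg d (by omega)
    have h3 := one_sub_growth_le hs hc hN (h4 d (by omega))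
    have h5 : (numDepth V c d : ℝ) ≤ 2 ^ d := by exact_mod_cast numDepth_le_two_pow hs hc d
    set e : ℝ := (V.card : ℝ) ^ (-(1 / 9) : ℝ) + 6 * 2 ^ d / V.card with he
    have he0 : 0 ≤ e := by positivity
    have h6 : (1 - growth V c d) * numDepth V c d ≤ e * 2 ^ d :=
      (mul_le_mul_of_nonneg_right h3 (Nat.cast_nonneg _)).trans
        (mul_le_mul_of_nonneg_left h5 he0)
    have h7 : (2 : ℝ) ^ (d + 1) *
        (1 - ((d + 1 : ℕ) * (V.card : ℝ) ^ (-(1 / 9) : ℝ) + 6 * 2 ^ (d + 1) / V.card)) =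
        2 * (2 ^ d * (1 - (d * (V.card : ℝ) ^ (-(1 / 9) : ℝ) + 6 * 2 ^ d / V.card))) -
          2 * (e * 2 ^ d) := by
      rw [he]
      push_cast
      ring
    rw [h7]
    linarith

/-- The sizes of the spheres and the growth factors up to depth `d` are determined by the history
up to depth `d`. -/
theorem growth_congr {c' : Layers} (hs : source ∈ V) (hc : c ∈ layerSet V)
    (h : history V d c' = history V d c) :
    (∀ k ≤ d, numDepth V c' k = numDepth V c k) ∧ growth V c' d = growth V c d ∧
      (GrowsUpTo V c' d ↔ GrowsUpTo V c d) := by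
  rw [history_eq_iff hs hc] at h
  have h1 : ∀ k ≤ d, numDepth V c' k = numDepth V c k := fun k hk => by
    rw [numDepth_eq, numDepth_eq, sphere_congr hs hc h hk]
  have h2 : ∀ k ≤ d, growth V c' k = growth V c k := fun k hk => by
    unfold growth
    rw [h1 k hk, numFrom_eq, numFrom_eq, ball_congr hs hc h (by omega)]
  refine ⟨h1, h2 d le_rfl, forall_congr' fun k => forall_congr' fun hk => ?_⟩
  rw [h1 k (by omega), h1 (k + 1) (by omega), h2 k (by omega)]

theorem collision_bound {n M N : ℝ} (hN : 0 < N) (hM : N / 2 ≤ M) (hn : 0 ≤ n)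
    (hnN : n ≤ N ^ (1 / 3 : ℝ)) : 3 * n ^ 2 / M ≤ 6 * N ^ (-(1 / 3) : ℝ) := by
  calc 3 * n ^ 2 / M ≤ 3 * (N ^ (1 / 3 : ℝ)) ^ 2 / (N / 2) := by
        refine div_le_div₀ (by positivity) ?_ (by positivity) hM
        gcongr
    _ = 6 * N ^ (-(1 / 3) : ℝ) := by
        have h : (-(1 / 3) : ℝ) = 1 / 3 + 1 / 3 - 1 := by norm_num
        rw [h, Real.rpow_sub hN, Real.rpow_add hN, Real.rpow_one]
        field_simp
        norm_num

theorem intermediate_deviation_bound {n M N : ℝ} (hN : 1 ≤ N) (hM : N / 2 ≤ M - 1) (hn : 0 < n) :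
    3 * n ^ 2 / ((M - 1) * (n * N ^ (-(1 / 9) : ℝ)) ^ 2) ≤ 24 * N ^ (-(2 / 3) : ℝ) := by
  have hN0 : 0 < N := by linarith
  have hpos : (0 : ℝ) < N ^ (1 / 9 : ℝ) := by positivity
  calc 3 * n ^ 2 / ((M - 1) * (n * N ^ (-(1 / 9) : ℝ)) ^ 2)
      ≤ 3 * n ^ 2 / (N / 2 * (n * N ^ (-(1 / 9) : ℝ)) ^ 2) := by gcongr
    _ = 6 * N ^ (-(7 / 9) : ℝ) := by
      have h : (-(7 / 9) : ℝ) = 1 / 9 + 1 / 9 - 1 := by norm_num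
      rw [h, Real.rpow_sub hN0, Real.rpow_add hN0, Real.rpow_one, Real.rpow_neg hN0.le]
      field_simp
      norm_num
    _ ≤ 24 * N ^ (-(2 / 3) : ℝ) := by
      have h5 : N ^ (-(7 / 9) : ℝ) ≤ N ^ (-(2 / 3) : ℝ) :=
        Real.rpow_le_rpow_of_exponent_le hN (by norm_num)
      have h6 : 0 < N ^ (-(2 / 3) : ℝ) := by positivity
      linarith

theorem late_deviation_bound {n M N : ℝ} (hN : 0 < N) (hM : N / 2 ≤ M - 1) (hMN : M ≤ N)
    (hn : N ^ (5 / 6 : ℝ) / 2 ≤ n) :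
    3 * n ^ 2 / ((M - 1) * (n ^ 2 / M) ^ 2) ≤ 24 * N ^ (-(2 / 3) : ℝ) := by
  have hM0 : 0 < M := by linarith
  have hpos : (0 : ℝ) < N ^ (5 / 6 : ℝ) := by positivity
  have hn0 : 0 < n := by linarith
  calc 3 * n ^ 2 / ((M - 1) * (n ^ 2 / M) ^ 2)
      ≤ 3 * n ^ 2 / (N / 2 * (n ^ 2 / M) ^ 2) := by gcongr
    _ = 6 * M ^ 2 / (N * n ^ 2) := by field_simp; norm_num
    _ ≤ 6 * N ^ 2 / (N * (N ^ (5 / 6 : ℝ) / 2) ^ 2) := by gcongr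
    _ = 24 * N ^ (-(2 / 3) : ℝ) := by
      have h5 : (-(2 / 3) : ℝ) = 1 - (5 / 6 + 5 / 6) := by norm_num
      rw [h5, Real.rpow_sub hN, Real.rpow_add hN, Real.rpow_one]
      field_simp
      norm_num

/-- A bound on the probability that the growth bound first fails at depth `d`, given the history.
In the initial regime a failure means a collision, which Markov's inequality excludes; in the other
two regimes the slack in the growth factor exceeds the standard deviation by a power of `|V|`. -/
theorem card_filter_growth_lt (hs : source ∈ V) (hc : c ∈ layerSet V) (hN : 4 ≤ V.card)
    (h8 : 8 * 2 ^ d ≤ V.card)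
    (hmid : d < depthTwo V.card → 6 * (2 : ℝ) ^ d / V.card ≤ (V.card : ℝ) ^ (-(1 / 9) : ℝ))
    (hn : (2 : ℝ) ^ d / 2 ≤ numDepth V c d) :
    (((layerSet V).filter fun c' => history V d c' = history V d c ∧
        (numDepth V c' (d + 1) : ℝ) < 2 * growth V c d * numDepth V c d).card : ℝ) ≤
      ((layerSet V).filter fun c' => history V d c' = history V d c).card *
        if d < depthOne V.card then 6 * (V.card : ℝ) ^ (-(1 / 3) : ℝ)
        else 24 * (V.card : ℝ) ^ (-(2 / 3) : ℝ) := by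
  have hN0 : 0 < V.card := by omega
  have hNr : (0 : ℝ) < V.card := by exact_mod_cast hN0
  have hM := half_card_le_numFrom_sub_one hs hc hN (d := d) (by omega)
  have hy := numDepth_div_numFrom_le hs hc hN (d := d) (by omega)
  have hn2 : (numDepth V c d : ℝ) ≤ 2 ^ d := by exact_mod_cast numDepth_le_two_pow hs hc d
  have hM1 : 1 < numFrom V c d := by
    have : (1 : ℝ) < numFrom V c d := by linarith
    exact_mod_cast this
  have hn0 : (0 : ℝ) < numDepth V c d := lt_of_lt_of_le (by positivity) hn
  have hM0 : (0 : ℝ) < numFrom V c d := by linarith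
  by_cases h1 : d < depthOne V.card
  · have hgr : growth V c d = 1 := if_pos h1
    rw [hgr, mul_one, if_pos h1]
    refine (card_filter_numDepth_succ_lt_two_mul hs hc (by omega)).trans
      (mul_le_mul_of_nonneg_left ?_ (Nat.cast_nonneg _))
    exact collision_bound hNr (by linarith) hn0.le
      (hn2.trans (two_pow_le_of_lt_depthOne hN0 h1))
  rw [if_neg h1]
  by_cases h2 : d < depthTwo V.card
  · have hgr : growth V c d = 1 - (V.card : ℝ) ^ (-(1 / 9) : ℝ) := by
      rw [growth, if_neg h1, if_pos h2]
    rw [hgr]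
    have h3 : (0 : ℝ) < (V.card : ℝ) ^ (-(1 / 9) : ℝ) := by positivity
    refine (card_filter_numDepth_succ_lt hs hc hM1
      (t := numDepth V c d * (V.card : ℝ) ^ (-(1 / 9) : ℝ)) (mul_pos hn0 h3)
      ?_).trans (mul_le_mul_of_nonneg_left ?_ (Nat.cast_nonneg _))
    · have h5 : 3 * (numDepth V c d : ℝ) ^ 2 / numFrom V c d =
          numDepth V c d * (3 * (numDepth V c d / numFrom V c d)) := by ring
      have h6 : 3 * ((numDepth V c d : ℝ) / numFrom V c d) ≤ (V.card : ℝ) ^ (-(1 / 9) : ℝ) := by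
        refine le_trans ?_ (hmid h2)
        calc 3 * ((numDepth V c d : ℝ) / numFrom V c d) ≤ 3 * (2 * 2 ^ d / V.card) := by
              linarith
          _ = 6 * 2 ^ d / V.card := by ring
      have h7 := mul_le_mul_of_nonneg_left h6 hn0.le
      rw [h5]
      linarith
    · exact intermediate_deviation_bound (by exact_mod_cast hN0) hM hn0
  · have hgr : growth V c d = (1 - (numDepth V c d : ℝ) / numFrom V c d) ^ 3 := by
      rw [growth, if_neg h1, if_neg h2]
    rw [hgr]
    have h3 := le_two_pow_of_depthTwo_le hN0 (not_lt.1 h2)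
    refine (card_filter_numDepth_succ_lt hs hc hM1
      (t := (numDepth V c d : ℝ) ^ 2 / numFrom V c d) (by positivity)
      ?_).trans (mul_le_mul_of_nonneg_left ?_ (Nat.cast_nonneg _))
    · have hy1 : (numDepth V c d : ℝ) / numFrom V c d ≤ 1 / 4 := by
        refine hy.trans ?_
        have : (8 : ℝ) * 2 ^ d ≤ V.card := by exact_mod_cast h8
        rw [div_le_iff₀ hNr]
        linarith
      have hy0 : 0 ≤ (numDepth V c d : ℝ) / numFrom V c d := by positivity
      have e1 : (numDepth V c d : ℝ) ^ 2 / numFrom V c d =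
        numDepth V c d * (numDepth V c d / numFrom V c d) := by ring
      have e2 : 3 * (numDepth V c d : ℝ) ^ 2 / numFrom V c d =
        numDepth V c d * (3 * (numDepth V c d / numFrom V c d)) := by ring
      rw [e1, e2]
      generalize (numDepth V c d : ℝ) / numFrom V c d = y at hy1 hy0 ⊢
      have h5 : 0 ≤ 2 * numDepth V c d * (y * (1 - 3 * y + y ^ 2)) :=
        mul_nonneg (by positivity) (mul_nonneg hy0 (by linarith [sq_nonneg y]))
      linarith
    · refine late_deviation_bound hNr hM ?_ (by linarith)
      rw [numFrom_eq]
      exact_mod_cast Finset.card_le_card Finset.sdiff_subset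

theorem card_filter_first_failure_le (hs : source ∈ V) (hN : 4 ≤ V.card)
    (h8 : 8 * 2 ^ d ≤ V.card)
    (hmid : d < depthTwo V.card → 6 * (2 : ℝ) ^ d / V.card ≤ (V.card : ℝ) ^ (-(1 / 9) : ℝ))
    (hlow : ∀ c ∈ layerSet V, GrowsUpTo V c d → (2 : ℝ) ^ d / 2 ≤ numDepth V c d) :
    (((layerSet V).filter fun c => GrowsUpTo V c d ∧
        (numDepth V c (d + 1) : ℝ) < 2 * growth V c d * numDepth V c d).card : ℝ) ≤
      (layerSet V).card * if d < depthOne V.card then 6 * (V.card : ℝ) ^ (-(1 / 3) : ℝ)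
        else 24 * (V.card : ℝ) ^ (-(2 / 3) : ℝ) := by
  refine card_filter_le_of_fiberwise (layerSet V) (history V d)
    (fun c => GrowsUpTo V c d ∧
      (numDepth V c (d + 1) : ℝ) < 2 * growth V c d * numDepth V c d) _ fun c hc => ?_
  by_cases hg : GrowsUpTo V c d
  · have h0 := card_filter_growth_lt hs hc hN h8 hmid (hlow c hc hg)
    refine le_trans (Nat.cast_le.2 (Finset.card_le_card ?_)) h0
    intro c' hc'
    rw [Finset.mem_filter] at hc' ⊢
    obtain ⟨hc'1, h, -, h'⟩ := hc'
    obtain ⟨h1, h2, -⟩ := growth_congr hs hc h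
    rw [h1 d le_rfl, h2] at h'
    exact ⟨hc'1, h, h'⟩
  · rw [Finset.filter_eq_empty_iff.2]
    · rw [Finset.card_empty, Nat.cast_zero]
      refine mul_nonneg (Nat.cast_nonneg _) ?_
      split_ifs <;> positivity
    · rintro c' - ⟨h, h', -⟩
      exact hg ((growth_congr hs hc h).2.2.1 h')

/-- A union bound over the depth of the first failure. -/
theorem card_filter_not_growsUpTo_le (hs : source ∈ V) (hN : 4 ≤ V.card) {D : ℕ}
    (h8 : ∀ d < D, 8 * 2 ^ d ≤ V.card)
    (hmid : ∀ d < depthTwo V.card, 6 * (2 : ℝ) ^ d / V.card ≤ (V.card : ℝ) ^ (-(1 / 9) : ℝ))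
    (hlow : ∀ d < D, ∀ c ∈ layerSet V, GrowsUpTo V c d → (2 : ℝ) ^ d / 2 ≤ numDepth V c d) :
    (((layerSet V).filter fun c => ¬ GrowsUpTo V c D).card : ℝ) ≤
      (layerSet V).card * (depthOne V.card * (6 * (V.card : ℝ) ^ (-(1 / 3) : ℝ)) +
        D * (24 * (V.card : ℝ) ^ (-(2 / 3) : ℝ))) := by
  have hsub : ((layerSet V).filter fun c => ¬ GrowsUpTo V c D) ⊆
      (Finset.range D).biUnion fun d => (layerSet V).filter fun c => GrowsUpTo V c d ∧
        (numDepth V c (d + 1) : ℝ) < 2 * growth V c d * numDepth V c d := by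
    intro c hc
    obtain ⟨hcV, hg⟩ := Finset.mem_filter.1 hc
    have hex : ∃ k, k < D ∧ ¬ 2 * growth V c k * (numDepth V c k : ℝ) ≤ numDepth V c (k + 1) := by
      simpa [GrowsUpTo] using hg
    obtain ⟨h1, h2⟩ := Nat.find_spec hex
    refine Finset.mem_biUnion.2 ⟨Nat.find hex, Finset.mem_range.2 h1,
      Finset.mem_filter.2 ⟨hcV, fun k hk => ?_, not_le.1 h2⟩⟩
    by_contra h
    exact Nat.find_min hex hk ⟨hk.trans h1, h⟩
  have hsum : ∑ d ∈ Finset.range D, (if d < depthOne V.card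
        then 6 * (V.card : ℝ) ^ (-(1 / 3) : ℝ) else 24 * (V.card : ℝ) ^ (-(2 / 3) : ℝ)) ≤
      depthOne V.card * (6 * (V.card : ℝ) ^ (-(1 / 3) : ℝ)) +
        D * (24 * (V.card : ℝ) ^ (-(2 / 3) : ℝ)) := by
    rw [Finset.sum_ite, Finset.sum_const, Finset.sum_const, nsmul_eq_mul, nsmul_eq_mul]
    have h1 : ((Finset.range D).filter fun d => d < depthOne V.card).card ≤ depthOne V.card := by
      rw [← Finset.card_range (depthOne V.card)]
      refine Finset.card_le_card fun d hd => Finset.mem_range.2 ?_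
      simpa using (Finset.mem_filter.1 hd).2
    have h2 : ((Finset.range D).filter fun d => ¬ d < depthOne V.card).card ≤ D :=
      (Finset.card_filter_le _ _).trans (Finset.card_range D).le
    gcongr
  calc (((layerSet V).filter fun c => ¬ GrowsUpTo V c D).card : ℝ)
      ≤ ∑ d ∈ Finset.range D, (((layerSet V).filter fun c => GrowsUpTo V c d ∧
        (numDepth V c (d + 1) : ℝ) < 2 * growth V c d * numDepth V c d).card : ℝ) := by
        exact_mod_cast (Finset.card_le_card hsub).trans Finset.card_biUnion_le
    _ ≤ ∑ d ∈ Finset.range D, (layerSet V).card * (if d < depthOne V.card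
        then 6 * (V.card : ℝ) ^ (-(1 / 3) : ℝ) else 24 * (V.card : ℝ) ^ (-(2 / 3) : ℝ)) := by
        refine Finset.sum_le_sum fun d hd => ?_
        have hd := Finset.mem_range.1 hd
        exact card_filter_first_failure_le hs hN (h8 d hd) (hmid d) (hlow d hd)
    _ ≤ _ := by
        rw [← Finset.mul_sum]
        exact mul_le_mul_of_nonneg_left hsum (Nat.cast_nonneg _)

end growth

/-! ### Asymptotics -/

theorem depthStar_bounds {c : ℝ} {N : ℕ} (hg1 : 1 ≤ Real.log N ^ c) (hgN : Real.log N ^ c ≤ N) :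
    (∀ d < depthStar c N, (2 : ℝ) ^ d ≤ N / Real.log N ^ c) ∧
      (N : ℝ) / Real.log N ^ c ≤ 2 ^ depthStar c N ∧
      (2 : ℝ) ^ depthStar c N ≤ 2 * (N / Real.log N ^ c) ∧
      (depthStar c N : ℝ) ≤ Real.logb 2 N + 1 := by
  have hg0 : 0 < Real.log N ^ c := by linarith
  have hN0 : (0 : ℝ) < N := by linarith
  set X : ℝ := N / Real.log N ^ c with hX
  have hX1 : 1 ≤ X := by rwa [hX, le_div_iff₀ hg0, one_mul]
  have hXN : X ≤ N := div_le_self hN0.le hg1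
  have hl0 : 0 ≤ Real.logb 2 X := Real.logb_nonneg (by norm_num) hX1
  have h2 : (2 : ℝ) ^ Real.logb 2 X = X :=
    Real.rpow_logb (by norm_num) (by norm_num) (by linarith)
  have hlt : (depthStar c N : ℝ) < Real.logb 2 X + 1 := Nat.ceil_lt_add_one hl0
  refine ⟨fun d hd => ?_, ?_, ?_, ?_⟩
  · rw [← h2, ← Real.rpow_natCast]
    exact Real.rpow_le_rpow_of_exponent_le (by norm_num) (Nat.lt_ceil.1 hd).le
  · conv_lhs => rw [← h2]
    rw [← Real.rpow_natCast]
    exact Real.rpow_le_rpow_of_exponent_le (by norm_num) (Nat.le_ceil _)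
  · calc (2 : ℝ) ^ depthStar c N = (2 : ℝ) ^ (depthStar c N : ℝ) := (Real.rpow_natCast _ _).symm
      _ ≤ (2 : ℝ) ^ (Real.logb 2 X + 1) :=
        Real.rpow_le_rpow_of_exponent_le (by norm_num) hlt.le
      _ = 2 * X := by rw [Real.rpow_add (by norm_num), h2, Real.rpow_one, mul_comm]
  · have := Real.logb_le_logb_of_le (b := 2) (by norm_num) (by linarith) hXN
    linarith

open Filter Topology in
theorem eventually_size_conditions (c : ℝ) (hc0 : 0 < c) (hc1 : c < 1) (ε : ℝ) (hε : 0 < ε) :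
    ∀ᶠ N : ℕ in atTop, 4 ≤ N ∧ 8 ≤ Real.log N ^ c ∧ Real.log N ^ c ≤ N ∧
      (Real.logb 2 N + 1) * (N : ℝ) ^ (-(1 / 9) : ℝ) + 12 / Real.log N ^ c ≤ min ε (1 / 2) ∧
      6 * (N : ℝ) ^ (-(1 / 6) : ℝ) ≤ (N : ℝ) ^ (-(1 / 9) : ℝ) ∧
      6 + 24 * ((Real.logb 2 N + 1) * (N : ℝ) ^ (-(1 / 3) : ℝ)) ≤ 2 * ε * Real.logb 2 N := by
  have hcast : Tendsto (fun N : ℕ => (N : ℝ)) atTop atTop := tendsto_natCast_atTop_atTop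
  have hlog : Tendsto (fun N : ℕ => Real.log N) atTop atTop := Real.tendsto_log_atTop.comp hcast
  have hg : Tendsto (fun N : ℕ => Real.log N ^ c) atTop atTop :=
    (tendsto_rpow_atTop hc0).comp hlog
  have hpow : ∀ r : ℝ, 0 < r → Tendsto (fun N : ℕ => (N : ℝ) ^ (-r)) atTop (𝓝 0) :=
    fun r hr => (tendsto_rpow_neg_atTop hr).comp hcast
  have hlogb : Tendsto (fun N : ℕ => Real.logb 2 N) atTop atTop := by
    have : (fun N : ℕ => Real.logb 2 N) = fun N : ℕ => Real.log N / Real.log 2 := rfl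
    rw [this]
    exact hlog.atTop_div_const (Real.log_pos (by norm_num))
  have hprod : ∀ r : ℝ, 0 < r →
      Tendsto (fun N : ℕ => (Real.logb 2 N + 1) * (N : ℝ) ^ (-r)) atTop (𝓝 0) := by
    intro r hr
    have h1 : Tendsto (fun N : ℕ => Real.log N / (N : ℝ) ^ r) atTop (𝓝 0) :=
      (isLittleO_log_rpow_atTop hr).tendsto_div_nhds_zero.comp hcast
    have h2 := (h1.div_const (Real.log 2)).add (hpow r hr)
    rw [zero_div, add_zero] at h2
    refine h2.congr fun N => ?_
    rw [Real.rpow_neg (Nat.cast_nonneg N), Real.logb]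
    ring
  have h3 : Tendsto (fun N : ℕ => (Real.logb 2 N + 1) * (N : ℝ) ^ (-(1 / 9) : ℝ) +
      12 / Real.log N ^ c) atTop (𝓝 0) := by
    simpa using (hprod (1 / 9) (by norm_num)).add (hg.const_div_atTop 12)
  filter_upwards [eventually_ge_atTop 4, hg.eventually_ge_atTop 8, hlog.eventually_ge_atTop 1,
    h3.eventually (ge_mem_nhds (lt_min hε (by norm_num : (0 : ℝ) < 1 / 2))),
    (hpow (1 / 18) (by norm_num)).eventually (ge_mem_nhds (by norm_num : (0 : ℝ) < 1 / 6)),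
    (hprod (1 / 3) (by norm_num)).eventually (ge_mem_nhds (by norm_num : (0 : ℝ) < 1)),
    (hlogb.const_mul_atTop (by positivity : 0 < 2 * ε)).eventually_ge_atTop 30]
    with N hN hg8 hlog1 h3 h4 h5 h6
  have hN0 : (0 : ℝ) < N := by exact_mod_cast (by omega : 0 < N)
  refine ⟨hN, hg8, ?_, h3, ?_, by linarith⟩
  · calc Real.log N ^ c ≤ Real.log N ^ (1 : ℝ) :=
          Real.rpow_le_rpow_of_exponent_le hlog1 hc1.le
      _ = Real.log N := Real.rpow_one _
      _ ≤ N := Real.log_le_self hN0.le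
  · have h7 : (-(1 / 6) : ℝ) = -(1 / 9) + -(1 / 18) := by norm_num
    rw [h7, Real.rpow_add hN0]
    have h8 : (0 : ℝ) < (N : ℝ) ^ (-(1 / 9) : ℝ) := by positivity
    have h9 := mul_le_mul_of_nonneg_left h4 h8.le
    linarith

theorem proposition3 (c : ℝ) (hc0 : 0 < c) (hc1 : c < 1) (ε : ℝ) (hε : 0 < ε) :
    ∃ N₀ : ℕ, ∀ N : ℕ, N₀ < N →
      ∀ (V : Finset ℕ) (μ : PMF Layers), PeerPairingLaw V μ → V.card = N →
        1 - 2 * (1 + ε) * Real.logb 2 N / (N : ℝ) ^ (1 / 3 : ℝ) ≤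
          (μ.toOuterMeasure
            {L : Layers |
              (1 - ε) * N / Real.log N ^ c ≤ (numDepth V L (depthStar c N) : ℝ) ∧
              ∀ d : ℕ, 1 ≤ d → d ≤ depthStar c N →
                2 * growth V L (d - 1) * (numDepth V L (d - 1) : ℝ) ≤
                  (numDepth V L d : ℝ)}).toReal := by
  classical
  obtain ⟨N₀, hN₀⟩ := Filter.eventually_atTop.1 (eventually_size_conditions c hc0 hc1 ε hε)
  refine ⟨N₀, fun N hN V μ hμ hV => ?_⟩
  obtain ⟨hN4, hg8, hgN, hδ, hmid, htail⟩ := hN₀ N hN.le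
  obtain ⟨hD1, hD2, hD3, hD4⟩ := depthStar_bounds (by linarith) hgN
  obtain ⟨hs, rfl⟩ := hμ.eq_uniform
  subst hV
  set D : ℕ := depthStar c V.card with hD
  set N : ℝ := (V.card : ℝ) with hN_def
  set g : ℝ := Real.log N ^ c with hg
  have hg0 : 0 < g := by linarith
  have hN0 : 0 < N := by linarith
  have hx0 : (0 : ℝ) < N ^ (-(1 / 9) : ℝ) := by positivity
  have h8 : ∀ d < D, 8 * 2 ^ d ≤ V.card := by
    intro d hd
    have h1 : (8 : ℝ) * 2 ^ d ≤ N := by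
      have h2 := hD1 d hd
      rw [le_div_iff₀ hg0] at h2
      exact le_trans (by rw [mul_comm]; gcongr) h2
    rw [hN_def] at h1
    exact_mod_cast h1
  have hδ' : ∀ d ≤ D, (d : ℝ) * N ^ (-(1 / 9) : ℝ) + 6 * 2 ^ d / N ≤ min ε (1 / 2) := by
    intro d hd
    refine le_trans (add_le_add ?_ ?_) hδ
    · refine mul_le_mul_of_nonneg_right ?_ hx0.le
      exact le_trans (by exact_mod_cast hd) hD4
    · calc 6 * (2 : ℝ) ^ d / N ≤ 6 * 2 ^ D / N := by
            gcongr
            norm_num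
        _ ≤ 6 * (2 * (N / g)) / N := by gcongr
        _ = 12 / g := by
            field_simp
            norm_num
  have hlower : ∀ d ≤ D, ∀ L ∈ layerSet V, GrowsUpTo V L d →
      (2 : ℝ) ^ d * (1 - min ε (1 / 2)) ≤ numDepth V L d := by
    intro d hd L hL hgr
    refine le_trans (mul_le_mul_of_nonneg_left ?_ (by positivity)) (two_pow_mul_le_numDepth hs hL
      hN4 (fun k hk => by have := h8 k (by omega); omega) hgr)
    linarith [hδ' d hd]
  have hfail := card_filter_not_growsUpTo_le hs hN4 h8
    (fun d hd => by
      refine le_trans ?_ hmid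
      have h1 := two_pow_le_of_lt_depthTwo (by omega) hd
      have h2 : (-(1 / 6) : ℝ) = 5 / 6 - 1 := by norm_num
      rw [h2, Real.rpow_sub hN0, Real.rpow_one, ← mul_div_assoc]
      gcongr)
    (fun d hd L hL hgr => by
      refine le_trans ?_ (hlower d hd.le L hL hgr)
      have h1 := min_le_right ε (1 / 2)
      have h2 : (0 : ℝ) < 2 ^ d := by positivity
      rw [div_eq_mul_inv]
      exact mul_le_mul_of_nonneg_left (by linarith) h2.le)
  have herr : (depthOne V.card : ℝ) * (6 * N ^ (-(1 / 3) : ℝ)) + D * (24 * N ^ (-(2 / 3) : ℝ)) ≤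
      2 * (1 + ε) * Real.logb 2 N / N ^ (1 / 3 : ℝ) := by
    have hl0 : 0 ≤ Real.logb 2 N := Real.logb_nonneg (by norm_num) (by linarith)
    have h1 : (depthOne V.card : ℝ) ≤ Real.logb 2 N / 3 + 1 :=
      (Nat.ceil_lt_add_one (by positivity)).le
    have h2 : N ^ (-(2 / 3) : ℝ) = N ^ (-(1 / 3) : ℝ) * N ^ (-(1 / 3) : ℝ) := by
      rw [← Real.rpow_add hN0]
      norm_num
    have h3 : (0 : ℝ) < N ^ (-(1 / 3) : ℝ) := by positivity
    rw [div_eq_mul_inv _ (N ^ (1 / 3 : ℝ)), ← Real.rpow_neg hN0.le, h2]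
    calc (depthOne V.card : ℝ) * (6 * N ^ (-(1 / 3) : ℝ)) +
          D * (24 * (N ^ (-(1 / 3) : ℝ) * N ^ (-(1 / 3) : ℝ)))
        ≤ (Real.logb 2 N / 3 + 1) * (6 * N ^ (-(1 / 3) : ℝ)) +
          (Real.logb 2 N + 1) * (24 * (N ^ (-(1 / 3) : ℝ) * N ^ (-(1 / 3) : ℝ))) := by
          gcongr
      _ = (2 * Real.logb 2 N + (6 + 24 * ((Real.logb 2 N + 1) * N ^ (-(1 / 3) : ℝ)))) *
          N ^ (-(1 / 3) : ℝ) := by ring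
      _ ≤ 2 * (1 + ε) * Real.logb 2 N * N ^ (-(1 / 3) : ℝ) := by
          refine mul_le_mul_of_nonneg_right ?_ h3.le
          linarith
  rw [PMF.toOuterMeasure_uniformOfFinset_apply, ENNReal.toReal_div, ENNReal.toReal_natCast,
    ENNReal.toReal_natCast, le_div_iff₀ (by exact_mod_cast (layerSet_nonempty V).card_pos)]
  have hsplit := Finset.card_filter_add_card_filter_not (s := layerSet V) fun L => GrowsUpTo V L D
  have hsplit' : (((layerSet V).filter fun L => GrowsUpTo V L D).card : ℝ) +
      ((layerSet V).filter fun L => ¬ GrowsUpTo V L D).card = (layerSet V).card := by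
    exact_mod_cast hsplit
  have hgood : (((layerSet V).filter fun L => GrowsUpTo V L D).card : ℝ) ≤
      ((layerSet V).filter fun L => L ∈ {L : Layers |
        (1 - ε) * N / g ≤ (numDepth V L D : ℝ) ∧ ∀ d : ℕ, 1 ≤ d → d ≤ D →
          2 * growth V L (d - 1) * (numDepth V L (d - 1) : ℝ) ≤ (numDepth V L d : ℝ)}).card := by
    refine Nat.cast_le.2 (Finset.card_le_card fun L hL => ?_)
    obtain ⟨hLV, hgr⟩ := Finset.mem_filter.1 hL
    refine Finset.mem_filter.2 ⟨hLV, ?_, fun d hd1 hd => ?_⟩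
    · refine le_trans ?_ (hlower D le_rfl L hLV hgr)
      have h1 := min_le_left ε (1 / 2)
      have h2 := min_le_right ε (1 / 2)
      calc (1 - ε) * N / g = N / g * (1 - ε) := by ring
        _ ≤ N / g * (1 - min ε (1 / 2)) :=
          mul_le_mul_of_nonneg_left (by linarith) (by positivity)
        _ ≤ 2 ^ D * (1 - min ε (1 / 2)) :=
          mul_le_mul_of_nonneg_right hD2 (by linarith)
    · obtain ⟨k, rfl⟩ := Nat.exists_eq_add_of_le' hd1
      exact hgr k (by omega)
  have h1 := mul_le_mul_of_nonneg_left herr (Nat.cast_nonneg (α := ℝ) (layerSet V).card)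
  refine le_trans ?_ (hgood.trans (le_of_eq ?_))
  · linarith
  · congr!
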